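/- A plane tree is a rooted tree in which the children of every vertex are linearly ordered; a leaf is a vertex without children. The protection number of a plane tree is the minimal distance of its root to a leaf. For $n\ge 1$ let $X_n$ be the protection number of a plane tree chosen uniformly at random among all plane trees with $n$ vertices. For integers $k\ge 0$ set $$a_k=\frac{27\cdot 4^k(4^{2k}-1)}{(4^k+2)^2(2\cdot 4^k+1)^2},$$ $$b_k=\frac{81\cdot 4^k\bigl(4(k-3)4^{6k}+36\cdot 4^{5k}-(45k-72)4^{4k}-80k\,4^{3k}-(45k+72)4^{2k}-36\cdot 4^k+4(k+3)\bigr)}{2(4^k+2)^4(2\cdot 4^k+1)^4}.$$ Then, as $n\to\infty$, $X_n$ tends to a discrete limit distribution: $a_k\ge 0$ for all $k$, $\sum_{k\ge 0}a_k=1$, $\lim_{n\to\infty}\mathbb{P}(X_n=k)=a_k$ for every $k$, and $$\mathbb{P}(X_n=k)=a_k+\frac{b_k}{n}+O\Bigl(\frac{k^2}{3^k n^{3/2}}\Bigr)\qquad(n\to\infty)$$ uniformly in $k\ge 0$, i.e. there are $C$ and $N$ such that for all $n\ge N$ and all $k\ge 0$ the error is at most $C k^2 3^{-k} n^{-3/2}$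 in absolute value. Moreover, with the (convergent) series $$c_0=\sum_{k\ge 1}\frac{9\cdot 4^k}{(4^k+2)^2}=1.622971384715353049514658203184345989635513668984063539407825\ldots,$$ $$c_1=\sum_{k\ge 1}\frac{9\cdot 4^k\bigl((3k-8)4^{2k}+28\cdot 4^k-(12k+20)\bigr)}{2(4^k+2)^4}=0.1311873689494231825244485810366733833577429413531428274982796\ldots,$$ $$c_2=\sum_{k\ge 1}\frac{9(2k-1)4^k}{(4^k+2)^2}-c_0^2=0.71569507178333266731548919868273628601066118785422617431075\ldots,$$ $$c_3=\sum_{k\ge 1}\frac{9(2k-1)4^k\bigl((3k-8)4^{2k}+28\cdot 4^k-(12k+20)\bigr)}{2(4^k+2)^4}-2c_0c_1=0.752064239409591264131776195623037076243863867774117959593385\ldots$$ (decimals correct to within one unit of the last digit shown), expectation and variance satisfy, as $n\to\infty$, $$\mathbb{E}(X_n)=c_0+\frac{c_1}{n}+O\bigl(n^{-3/2}\bigr),\qquad \mathbb{V}(X_n)=c_2+\frac{c_3}{n}+O\bigl(n^{-3/2}\bigr).$$ -/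

import Mathlib

open Filter Topology Asymptotics MeasureTheory ProbabilityTheory

/-- Rooted plane (ordered) trees: a root together with the finite sequence, possibly empty, of the
subtrees rooted at its children. -/
inductive PlaneTree : Type
  | node (branches : List PlaneTree) : PlaneTree

namespace PlaneTree

/-- The number of vertices of a plane tree. -/
def numVertices : PlaneTree → ℕ
  | node ts => 1 + (ts.map fun t => numVertices t).sum

/-- `IsLeafDistance t d`: some leaf (childless vertex) of `t` is at distance `d` from the root. -/
inductive IsLeafDistance : PlaneTree → ℕ → Prop
  | leaf : IsLeafDistance (node []) 0
  | branch {ts : List PlaneTree} {t : PlaneTree} {d : ℕ} :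
      t ∈ ts → IsLeafDistance t d → IsLeafDistance (node ts) (d + 1)

/-- The protection number of (the root of) a plane tree: the minimal distance of the root to
a leaf. -/
noncomputable def protectionNumber (t : PlaneTree) : ℕ :=
  sInf {d : ℕ | IsLeafDistance t d}

/-- The set of plane trees with `n` vertices. -/
def ofSize (n : ℕ) : Set PlaneTree := {t | t.numVertices = n}

/-- Every set of plane trees is an event. -/
instance : MeasurableSpace PlaneTree := ⊤

/-- The law of a uniformly random plane tree with `n` vertices. -/
noncomputable def uniformLaw (n : ℕ) : Measure PlaneTree := uniformOn (ofSize n)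

/-- There are only finitely many plane trees with `n` vertices, so that `uniformLaw` is the
uniform distribution on them. -/
theorem finite_ofSize (n : ℕ) : (ofSize n).Finite := by
  have pos : ∀ t : PlaneTree, 1 ≤ t.numVertices := by
    rintro ⟨ts⟩
    rw [numVertices]
    omega
  suffices h : {t : PlaneTree | t.numVertices ≤ n}.Finite from
    h.subset fun t ht => le_of_eq ht
  induction n with
  | zero =>
    refine Set.finite_empty.subset fun t ht => ?_
    have h1 := pos t
    have h2 : t.numVertices ≤ 0 := ht
    omega
  | succ n ih =>
    have : Finite {t : PlaneTree // t.numVertices ≤ n} := ih.to_subtype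
    refine ((List.finite_length_le {t : PlaneTree // t.numVertices ≤ n} n).image
      (fun l => node (l.map Subtype.val))).subset ?_
    rintro ⟨ts⟩ ht
    have ht' : (ts.map fun t => numVertices t).sum ≤ n := by
      have h : (node ts).numVertices ≤ n + 1 := ht
      rw [numVertices] at h
      omega
    have hmem : ∀ t ∈ ts, t.numVertices ≤ n := fun t h =>
      (List.le_sum_of_mem (List.mem_map_of_mem h)).trans ht'
    refine ⟨ts.pmap Subtype.mk hmem, ?_, ?_⟩
    · have h := List.length_le_sum_of_one_le (ts.map fun t => numVertices t) (by
        intro i hi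
        obtain ⟨t, -, rfl⟩ := List.mem_map.1 hi
        exact pos t)
      simp only [List.length_map] at h
      simpa using h.trans ht'
    · simp [List.map_pmap]

end PlaneTree

namespace ProtectionNumber

/-- The probability `P(X_n = k)`, where `X_n` is the protection number of a uniformly random plane
tree with `n` vertices. -/
noncomputable def prob (n k : ℕ) : ℝ :=
  (PlaneTree.uniformLaw n).real {t | t.protectionNumber = k}

/-- The expectation `E(X_n)`. -/
noncomputable def expectation (n : ℕ) : ℝ :=
  ∫ t, (t.protectionNumber : ℝ) ∂(PlaneTree.uniformLaw n)

/-- The variance `V(X_n)`. -/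
noncomputable def var (n : ℕ) : ℝ :=
  variance (fun t : PlaneTree => (t.protectionNumber : ℝ)) (PlaneTree.uniformLaw n)

/-- The limit probabilities. -/
noncomputable def limitProb (k : ℕ) : ℝ :=
  27 * 4 ^ k * (4 ^ (2 * k) - 1) / ((4 ^ k + 2) ^ 2 * (2 * 4 ^ k + 1) ^ 2)

/-- The coefficient of `1 / n` in the expansion of `P(X_n = k)`. -/
noncomputable def corrProb (k : ℕ) : ℝ :=
  81 * 4 ^ k *
      (4 * ((k : ℝ) - 3) * 4 ^ (6 * k) + 36 * 4 ^ (5 * k) - (45 * (k : ℝ) - 72) * 4 ^ (4 * k)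
        - 80 * (k : ℝ) * 4 ^ (3 * k) - (45 * (k : ℝ) + 72) * 4 ^ (2 * k) - 36 * 4 ^ k
        + 4 * ((k : ℝ) + 3)) /
    (2 * (4 ^ k + 2) ^ 4 * (2 * 4 ^ k + 1) ^ 4)

/-- The summand of the series for `c₀`. -/
noncomputable def term0 (k : ℕ) : ℝ :=
  9 * 4 ^ k / (4 ^ k + 2) ^ 2

/-- The summand of the series for `c₁`. -/
noncomputable def term1 (k : ℕ) : ℝ :=
  9 * 4 ^ k * ((3 * (k : ℝ) - 8) * 4 ^ (2 * k) + 28 * 4 ^ k - (12 * (k : ℝ) + 20)) /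
    (2 * (4 ^ k + 2) ^ 4)

/-- The summand of the series in `c₂`. -/
noncomputable def term2 (k : ℕ) : ℝ :=
  9 * (2 * (k : ℝ) - 1) * 4 ^ k / (4 ^ k + 2) ^ 2

/-- The summand of the series in `c₃`. -/
noncomputable def term3 (k : ℕ) : ℝ :=
  9 * (2 * (k : ℝ) - 1) * 4 ^ k *
      ((3 * (k : ℝ) - 8) * 4 ^ (2 * k) + 28 * 4 ^ k - (12 * (k : ℝ) + 20)) /
    (2 * (4 ^ k + 2) ^ 4)

/-! All series below run over `k ≥ 1`. -/

noncomputable def c0 : ℝ := ∑' k : ℕ, term0 (k + 1)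

noncomputable def c1 : ℝ := ∑' k : ℕ, term1 (k + 1)

noncomputable def c2 : ℝ := (∑' k : ℕ, term2 (k + 1)) - c0 ^ 2

noncomputable def c3 : ℝ := (∑' k : ℕ, term3 (k + 1)) - 2 * c0 * c1

end ProtectionNumber

open ProtectionNumber

/-!
The generating function `T_k` of the trees of protection number at least `k` satisfies
`T_0 = X + T_0 ^ 2` and `T_{k+1} = T_k (T_{k+1} + X)`, because the root of a tree counted by
`T_{k+1}` carries a nonempty sequence of trees counted by `T_k`. In terms of `1 / T_k` this
recursion is affine, so it has an explicit solution. Rationalising its denominator gives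
`T_{m+2} = X ^ m (1 - X) ^ 2 / D_m * T_0 + X ^ m R_m` with
`D_m = 1 + X ^ m (1 - 3 X) + X ^ (2 m + 3)` and `R_m` a power series. Both `1 / D_m` and `R_m` are
bounded, uniformly in `m`, in the weighted `ℓ¹` norm of radius `1 / 3`, which exceeds the radius of
convergence `1 / 4` of `T_0`: the summand `X ^ m R_m` is negligible, and the coefficients `t_n` of
`T_0` enter only through the ratios
`t_{n-j} / t_n = 4 ^ (-j) (1 + 3 j / (2 n) + O((1 + j) ^ 6 / n ^ 2))`.

The value and the first derivative of the factor of `T_0` at `1 / 4` therefore give the tail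
probabilities up to `O(3 ^ (-k) / n ^ 2)`, uniformly in `k`. Differences of consecutive tails are
the point probabilities, and summation by parts turns the tails into the moments.
-/

namespace PlaneTree

open PowerSeries

/-- The tree with a single vertex. -/
def single : PlaneTree := node []

/-- Attach `t` as a new leftmost branch to the root of `u`. Every plane tree other than `single` is
obtained in exactly one way. -/
def graft (t : PlaneTree) : PlaneTree → PlaneTree
  | node us => node (t :: us)

theorem eq_single_or_exists_graft : ∀ t : PlaneTree, t = single ∨ ∃ u v, t = graft u v
  | node [] => Or.inl rfl
  | node (u :: us) => Or.inr ⟨u, node us, rfl⟩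

theorem graft_ne_single (t u : PlaneTree) : graft t u ≠ single := by
  cases u
  simp [graft, single]

theorem graft_inj {t u t' u' : PlaneTree} : graft t u = graft t' u' ↔ t = t' ∧ u = u' := by
  cases u
  cases u'
  simp [graft]

theorem numVertices_single : single.numVertices = 1 := by
  simp [single, numVertices]

theorem numVertices_graft (t u : PlaneTree) :
    (graft t u).numVertices = t.numVertices + u.numVertices := by
  cases u
  simp only [graft, numVertices, List.map_cons, List.sum_cons]
  omega

theorem numVertices_pos (t : PlaneTree) : 0 < t.numVertices := by
  cases t
  rw [numVertices]
  omega

theorem exists_isLeafDistance : ∀ t : PlaneTree, ∃ d, IsLeafDistance t d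
  | node [] => ⟨0, .leaf⟩
  | node (t :: _) =>
    let ⟨d, hd⟩ := exists_isLeafDistance t
    ⟨d + 1, .branch List.mem_cons_self hd⟩

theorem le_protectionNumber_iff {t : PlaneTree} {k : ℕ} :
    k ≤ t.protectionNumber ↔ ∀ d, IsLeafDistance t d → k ≤ d :=
  ⟨fun h _ hd => h.trans (Nat.sInf_le hd), fun h => h _ (Nat.sInf_mem (exists_isLeafDistance t))⟩

theorem protectionNumber_single : single.protectionNumber = 0 :=
  Nat.le_zero.1 (Nat.sInf_le IsLeafDistance.leaf)

theorem succ_le_protectionNumber_graft {t u : PlaneTree} {k : ℕ} :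
    k + 1 ≤ (graft t u).protectionNumber ↔
      k ≤ t.protectionNumber ∧ (k + 1 ≤ u.protectionNumber ∨ u = single) := by
  obtain ⟨us⟩ := u
  simp only [le_protectionNumber_iff, graft]
  constructor
  · intro h
    refine ⟨fun d hd => by simpa using h _ (.branch List.mem_cons_self hd), ?_⟩
    rcases us with _ | ⟨v, vs⟩
    · exact Or.inr rfl
    · refine Or.inl fun d hd => ?_
      cases hd with
      | branch hmem hd => exact h _ (.branch (List.mem_cons_of_mem _ hmem) hd)
  · rintro ⟨ht, hu⟩ d hd
    cases hd with
    | branch hmem hd =>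
      rcases List.mem_cons.1 hmem with rfl | hmem
      · exact Nat.succ_le_succ (ht _ hd)
      · rcases hu with hu | hu
        · exact hu _ (.branch hmem hd)
        · simp only [single, node.injEq] at hu
          simp [hu] at hmem

/-- The finite set of plane trees with `n` vertices. -/
noncomputable def finsetOfSize (n : ℕ) : Finset PlaneTree := (finite_ofSize n).toFinset

theorem mem_finsetOfSize {n : ℕ} {t : PlaneTree} : t ∈ finsetOfSize n ↔ t.numVertices = n := by
  simp [finsetOfSize, ofSize]

theorem finsetOfSize_zero : finsetOfSize 0 = ∅ :=
  Finset.eq_empty_of_forall_notMem fun t ht => (numVertices_pos t).ne' (mem_finsetOfSize.1 ht)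

theorem sum_finsetOfSize_eq {M : Type*} [AddCommMonoid M] (f : PlaneTree → M) (n : ℕ) :
    ∑ t ∈ finsetOfSize n, f t =
      (if n = 1 then f single else 0) +
        ∑ p ∈ Finset.HasAntidiagonal.antidiagonal n,
          ∑ t ∈ finsetOfSize p.1, ∑ u ∈ finsetOfSize p.2, f (graft t u) := by
  classical
  rw [← Finset.sum_filter_add_sum_filter_not _ (· = single)]
  congr 1
  · rw [Finset.sum_filter]
    simp [mem_finsetOfSize, numVertices_single, eq_comm (a := 1)]
  · simp only [← Finset.sum_product']
    rw [Finset.sum_sigma']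
    symm
    refine Finset.sum_bij (fun x _ => graft x.2.1 x.2.2) ?_ ?_ ?_ fun _ _ => rfl
    · rintro ⟨⟨a, b⟩, t, u⟩ h
      simp_all [mem_finsetOfSize, numVertices_graft, graft_ne_single]
    · rintro ⟨⟨a, b⟩, t, u⟩ h ⟨⟨a', b'⟩, t', u'⟩ h' heq
      obtain ⟨rfl, rfl⟩ := graft_inj.1 heq
      simp only [Finset.mem_sigma, Finset.mem_product, mem_finsetOfSize] at h h'
      obtain ⟨-, rfl, rfl⟩ := h
      obtain ⟨-, rfl, rfl⟩ := h'
      rfl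
    · intro s hs
      rw [Finset.mem_filter, mem_finsetOfSize] at hs
      obtain ⟨t, u, rfl⟩ := (eq_single_or_exists_graft s).resolve_left hs.2
      refine ⟨⟨(t.numVertices, u.numVertices), t, u⟩, ?_, rfl⟩
      simp [mem_finsetOfSize, ← hs.1, numVertices_graft]

section genFun

variable {R : Type*} [Semiring R]

/-- The ordinary generating function, by number of vertices, of the plane trees weighted by `w`. -/
noncomputable def genFun (w : PlaneTree → R) : PowerSeries R :=
  PowerSeries.mk fun n => ∑ t ∈ finsetOfSize n, w t

theorem coeff_genFun (w : PlaneTree → R) (n : ℕ) :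
    coeff n (genFun w) = ∑ t ∈ finsetOfSize n, w t :=
  coeff_mk n _

theorem genFun_add (w w' : PlaneTree → R) : genFun (w + w') = genFun w + genFun w' := by
  ext n
  simp [coeff_genFun, Finset.sum_add_distrib]

theorem genFun_eq_of_graft {w p q : PlaneTree → R} (h : ∀ t u, w (graft t u) = p t * q u) :
    genFun w = C (w single) * X + genFun p * genFun q := by
  ext n
  rw [map_add, coeff_C_mul, coeff_X, mul_ite, mul_one, mul_zero, coeff_mul, coeff_genFun,
    sum_finsetOfSize_eq]
  simp only [coeff_genFun, h, Finset.sum_mul_sum]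

theorem genFun_indicator_single :
    genFun (({single} : Set PlaneTree).indicator (1 : PlaneTree → R)) = X := by
  have h := genFun_eq_of_graft (w := ({single} : Set PlaneTree).indicator (1 : PlaneTree → R))
    (p := 0) (q := 0) fun t u => by simp [graft_ne_single]
  have h0 : genFun (0 : PlaneTree → R) = 0 := by
    ext n
    simp [coeff_genFun]
  rw [h, h0]
  simp

end genFun

/-- The generating function of the plane trees with protection number at least `k`. -/
noncomputable def tailGenFun (k : ℕ) : PowerSeries ℝ :=
  genFun (Set.indicator {t | k ≤ t.protectionNumber} 1)

theorem tailGenFun_zero : tailGenFun 0 = X + tailGenFun 0 ^ 2 := by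
  have h := genFun_eq_of_graft (w := (1 : PlaneTree → ℝ)) (p := 1) (q := 1) fun t u => by simp
  simpa [tailGenFun, sq] using h

theorem tailGenFun_succ (k : ℕ) :
    tailGenFun (k + 1) = tailGenFun k * (tailGenFun (k + 1) + X) := by
  classical
  have h := genFun_eq_of_graft (R := ℝ) (w := Set.indicator {t | k + 1 ≤ t.protectionNumber} 1)
    (p := Set.indicator {t | k ≤ t.protectionNumber} 1)
    (q := Set.indicator {t | k + 1 ≤ t.protectionNumber} 1 + Set.indicator {single} 1)
    fun t u => by
      simp only [Pi.add_apply, Set.indicator_apply, Set.mem_ofPred_eq, Set.mem_singleton_iff,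
        succ_le_protectionNumber_graft]
      rcases eq_or_ne u single with rfl | hu
      · simp [protectionNumber_single]
      · simp [hu, ← ite_and, and_comm]
  rw [genFun_add, genFun_indicator_single,
    Set.indicator_of_notMem (by simp [protectionNumber_single]), map_zero, zero_mul, zero_add] at h
  exact h

theorem constantCoeff_tailGenFun_zero : constantCoeff (tailGenFun 0) = 0 := by
  rw [← coeff_zero_eq_constantCoeff_apply, tailGenFun, coeff_genFun, finsetOfSize_zero,
    Finset.sum_empty]

theorem tailGenFun_zero_eq_X_mul_catalanSeries :
    tailGenFun 0 = X * PowerSeries.map (Nat.castRingHom ℝ) catalanSeries := by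
  set F := PowerSeries.map (Nat.castRingHom ℝ) catalanSeries
  have hF : F ^ 2 * X + 1 = F := by
    simpa [F] using congrArg (PowerSeries.map (Nat.castRingHom ℝ)) catalanSeries_sq_mul_X_add_one
  have hmul : (tailGenFun 0 - X * F) * (1 - tailGenFun 0 - X * F) = 0 := by
    linear_combination tailGenFun_zero + X * hF
  refine sub_eq_zero.1 ((mul_eq_zero.1 hmul).resolve_right fun h => ?_)
  simpa [constantCoeff_tailGenFun_zero] using congrArg constantCoeff h

theorem coeff_succ_tailGenFun_zero (n : ℕ) : coeff (n + 1) (tailGenFun 0) = catalan n := by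
  rw [tailGenFun_zero_eq_X_mul_catalanSeries, coeff_succ_X_mul, coeff_map, catalanSeries_coeff]
  simp

/-- The recursion of `tailGenFun_succ` is a Möbius transformation, affine in `1 / tailGenFun k`;
this is its solution, with denominators cleared. -/
theorem tailGenFun_mul_eq (k : ℕ) :
    tailGenFun k * (1 - X - (1 - X ^ k) * tailGenFun 0) = X ^ k * (1 - X) * tailGenFun 0 := by
  induction k with
  | zero => ring
  | succ k ih =>
    linear_combination (tailGenFun (k + 1) + X) * ih +
      (1 - X - (1 - X ^ k) * tailGenFun 0) * tailGenFun_succ k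

/-- The denominator that remains when `tailGenFun_mul_eq` is solved for `tailGenFun (m + 2)` and the
square root in `tailGenFun 0` is moved to the numerator. -/
noncomputable def denom (m : ℕ) : PowerSeries ℝ := 1 + X ^ m * (1 - 3 * X) + X ^ (2 * m + 3)

/-- Multiply `tailGenFun_mul_eq` by the conjugate, in which `tailGenFun 0` becomes the other root
`1 - tailGenFun 0` of `T = X + T ^ 2`. -/
theorem tailGenFun_mul_denom (m : ℕ) :
    tailGenFun (m + 2) * denom m =
      X ^ m * (1 - X) * ((1 - X) * tailGenFun 0 - (1 - X ^ (m + 2)) * X) := by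
  refine mul_left_cancel₀ (pow_ne_zero 2 X_ne_zero : (X ^ 2 : PowerSeries ℝ) ≠ 0) ?_
  have h0 := tailGenFun_zero
  have h := tailGenFun_mul_eq (m + 2)
  unfold denom
  set T := tailGenFun 0
  set G := tailGenFun (m + 2)
  linear_combination (1 - X - (1 - X ^ (m + 2)) * (1 - T)) * h +
    (-G * (1 - X ^ (m + 2)) ^ 2 - X ^ (m + 2) * (1 - X) * (1 - X ^ (m + 2))) * h0

theorem denom_mul_inv_cancel (m : ℕ) : denom m * (denom m)⁻¹ = 1 :=
  PowerSeries.mul_inv_cancel _ (by rcases m with _ | m <;> simp [denom])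

/-- The factor of `X ^ m * tailGenFun 0` in `tailGenFun (m + 2)`. -/
noncomputable def mainFactor (m : ℕ) : PowerSeries ℝ := (1 - X) ^ 2 * (denom m)⁻¹

/-- The part of `tailGenFun (m + 2)`, up to the factor `X ^ m`, that is free of the square root. -/
noncomputable def regularPart (m : ℕ) : PowerSeries ℝ :=
  -(X * (1 - X) * (1 - X ^ (m + 2)) * (denom m)⁻¹)

theorem tailGenFun_eq (m : ℕ) :
    tailGenFun (m + 2) = X ^ m * mainFactor m * tailGenFun 0 + X ^ m * regularPart m := by
  unfold mainFactor regularPart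
  linear_combination (denom m)⁻¹ * tailGenFun_mul_denom m -
    tailGenFun (m + 2) * denom_mul_inv_cancel m

theorem tailGenFun_one : tailGenFun 1 = tailGenFun 0 - X := by
  have hne : (1 - tailGenFun 0 : PowerSeries ℝ) ≠ 0 := fun h => by
    simpa [constantCoeff_tailGenFun_zero] using congrArg constantCoeff h
  refine mul_left_cancel₀ hne ?_
  linear_combination tailGenFun_succ 0 - tailGenFun_zero

end PlaneTree

theorem sum_range_sum_antidiagonal_le {F : ℕ × ℕ → ℝ} (hF : ∀ p, 0 ≤ F p) (J : ℕ) :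
    ∑ n ∈ Finset.range J, ∑ p ∈ Finset.HasAntidiagonal.antidiagonal n, F p ≤
      ∑ p ∈ Finset.range J ×ˢ Finset.range J, F p := by
  rw [← Finset.sum_biUnion]
  · refine Finset.sum_le_sum_of_subset_of_nonneg (fun p hp => ?_) fun p _ _ => hF p
    simp only [Finset.mem_biUnion, Finset.mem_range, Finset.HasAntidiagonal.mem_antidiagonal,
      Finset.mem_product] at hp ⊢
    omega
  · refine fun a _ b _ hab => Finset.disjoint_left.2 fun p hp hq => hab ?_
    rw [← Finset.HasAntidiagonal.mem_antidiagonal.1 hp,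
      ← Finset.HasAntidiagonal.mem_antidiagonal.1 hq]

/-- The norm of the truncation below degree `J` of a power series in the algebra of power series
that converge absolutely at `ρ`. A bound that does not depend on `J` bounds the series itself. -/
noncomputable def truncNorm {R : Type*} [NormedRing R] (ρ : ℝ) (J : ℕ) (f : PowerSeries R) : ℝ :=
  ∑ j ∈ Finset.range J, ‖PowerSeries.coeff j f‖ * ρ ^ j

section truncNorm

open PowerSeries

variable {R : Type*} [NormedRing R] {ρ : ℝ}

theorem truncNorm_nonneg (hρ : 0 ≤ ρ) (J : ℕ) (f : PowerSeries R) : 0 ≤ truncNorm ρ J f :=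
  Finset.sum_nonneg fun _ _ => by positivity

theorem truncNorm_neg (J : ℕ) (f : PowerSeries R) : truncNorm ρ J (-f) = truncNorm ρ J f := by
  simp [truncNorm]

theorem truncNorm_add_le (hρ : 0 ≤ ρ) (J : ℕ) (f g : PowerSeries R) :
    truncNorm ρ J (f + g) ≤ truncNorm ρ J f + truncNorm ρ J g := by
  simp only [truncNorm, ← Finset.sum_add_distrib, ← add_mul, map_add]
  gcongr
  exact norm_add_le _ _

theorem truncNorm_sub_le (hρ : 0 ≤ ρ) (J : ℕ) (f g : PowerSeries R) :
    truncNorm ρ J (f - g) ≤ truncNorm ρ J f + truncNorm ρ J g := by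
  rw [sub_eq_add_neg, ← truncNorm_neg J g]
  exact truncNorm_add_le hρ J f (-g)

theorem norm_coeff_mul_pow_le_sum_antidiagonal (hρ : 0 ≤ ρ) (f g : PowerSeries R) (n : ℕ) :
    ‖coeff n (f * g)‖ * ρ ^ n ≤ ∑ p ∈ Finset.HasAntidiagonal.antidiagonal n,
      (‖coeff p.1 f‖ * ρ ^ p.1) * (‖coeff p.2 g‖ * ρ ^ p.2) := by
  rw [coeff_mul]
  refine (mul_le_mul_of_nonneg_right (norm_sum_le _ _) (by positivity)).trans ?_
  rw [Finset.sum_mul]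
  refine Finset.sum_le_sum fun p hp => ?_
  rw [← Finset.HasAntidiagonal.mem_antidiagonal.1 hp, mul_mul_mul_comm, ← pow_add]
  gcongr
  exact norm_mul_le _ _

theorem truncNorm_mul_le (hρ : 0 ≤ ρ) (J : ℕ) (f g : PowerSeries R) :
    truncNorm ρ J (f * g) ≤ truncNorm ρ J f * truncNorm ρ J g := by
  refine (Finset.sum_le_sum fun n _ => norm_coeff_mul_pow_le_sum_antidiagonal hρ f g n).trans ?_
  rw [truncNorm, truncNorm, Finset.sum_mul_sum, ← Finset.sum_product']
  exact sum_range_sum_antidiagonal_le (fun p => by positivity) J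

theorem truncNorm_mul_le_of_le (hρ : 0 ≤ ρ) {J : ℕ} {f g : PowerSeries R} {a b : ℝ}
    (hf : truncNorm ρ J f ≤ a) (hg : truncNorm ρ J g ≤ b) : truncNorm ρ J (f * g) ≤ a * b :=
  (truncNorm_mul_le hρ J f g).trans
    (mul_le_mul hf hg (truncNorm_nonneg hρ J g) ((truncNorm_nonneg hρ J f).trans hf))

theorem truncNorm_C_mul [NormMulClass R] (a : R) (J : ℕ) (f : PowerSeries R) :
    truncNorm ρ J (C a * f) = ‖a‖ * truncNorm ρ J f := by
  simp [truncNorm, Finset.mul_sum, mul_assoc]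

theorem truncNorm_X_pow_le [NormOneClass R] (hρ : 0 ≤ ρ) (J m : ℕ) :
    truncNorm ρ J (X ^ m : PowerSeries R) ≤ ρ ^ m := by
  classical
  have hterm : ∀ j, ‖coeff j (X ^ m : PowerSeries R)‖ * ρ ^ j = if j = m then ρ ^ m else 0 :=
    fun j => by rw [coeff_X_pow]; split_ifs with h <;> simp [h]
  simp only [truncNorm, hterm, Finset.sum_ite_eq']
  split_ifs
  exacts [le_rfl, by positivity]

theorem truncNorm_X_le [NormOneClass R] (hρ : 0 ≤ ρ) (J : ℕ) :
    truncNorm ρ J (X : PowerSeries R) ≤ ρ := by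
  simpa using truncNorm_X_pow_le (R := R) hρ J 1

theorem truncNorm_one_le [NormOneClass R] (hρ : 0 ≤ ρ) (J : ℕ) :
    truncNorm ρ J (1 : PowerSeries R) ≤ 1 := by
  simpa using truncNorm_X_pow_le (R := R) hρ J 0

/-- A Neumann series bound. Truncating first makes the norm of `g` finite, so that it can be
absorbed on the left. -/
theorem truncNorm_le_of_mul_eq_one [NormMulClass R] [NormOneClass R] (hρ : 0 ≤ ρ) {J : ℕ}
    {f g : PowerSeries R} {a : R} {c : ℝ} (hfg : f * g = 1) (hc : truncNorm ρ J (C a - f) ≤ c)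
    (ha : c < ‖a‖) : truncNorm ρ J g ≤ 1 / (‖a‖ - c) := by
  have key : ‖a‖ * truncNorm ρ J g ≤ 1 + c * truncNorm ρ J g :=
    calc ‖a‖ * truncNorm ρ J g = truncNorm ρ J (1 + (C a - f) * g) := by
          rw [← truncNorm_C_mul, sub_mul, hfg, add_sub_cancel]
      _ ≤ 1 + c * truncNorm ρ J g := (truncNorm_add_le hρ J _ _).trans
          (add_le_add (truncNorm_one_le hρ J) (truncNorm_mul_le_of_le hρ hc le_rfl))
  rw [le_div_iff₀ (sub_pos.2 ha)]
  linarith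

theorem norm_coeff_mul_pow_le (hρ : 0 ≤ ρ) {f : PowerSeries R} {K : ℝ}
    (h : ∀ J, truncNorm ρ J f ≤ K) (n : ℕ) : ‖coeff n f‖ * ρ ^ n ≤ K :=
  (Finset.single_le_sum (f := fun j => ‖coeff j f‖ * ρ ^ j) (fun _ _ => by positivity)
    (Finset.mem_range.2 n.lt_succ_self)).trans (h (n + 1))

theorem summable_norm_coeff_mul_pow (hρ : 0 ≤ ρ) {f : PowerSeries R} {K : ℝ}
    (h : ∀ J, truncNorm ρ J f ≤ K) : Summable fun j => ‖coeff j f‖ * ρ ^ j :=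
  summable_of_sum_range_le (fun _ => by positivity) h

theorem tsum_norm_coeff_mul_pow_le (hρ : 0 ≤ ρ) {f : PowerSeries R} {K : ℝ}
    (h : ∀ J, truncNorm ρ J f ≤ K) : ∑' j, ‖coeff j f‖ * ρ ^ j ≤ K :=
  Real.tsum_le_of_sum_range_le (fun _ => by positivity) h

end truncNorm

namespace PlaneTree

open PowerSeries

theorem truncNorm_one_sub_X_pow_le (k J : ℕ) :
    truncNorm (1 / 3) J (1 - X ^ k : PowerSeries ℝ) ≤ 1 + (1 / 3) ^ k :=
  (truncNorm_sub_le (by norm_num) J _ _).trans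
    (add_le_add (truncNorm_one_le (by norm_num) J) (truncNorm_X_pow_le (by norm_num) J k))

theorem truncNorm_two_sub_denom_zero_le (J : ℕ) :
    truncNorm (1 / 3) J (C 2 - denom 0) ≤ 28 / 27 := by
  have hρ : (0 : ℝ) ≤ 1 / 3 := by norm_num
  have h : C 2 - denom 0 = C 3 * X - X ^ 3 := by
    rw [denom, map_ofNat, map_ofNat]
    ring
  have h1 := truncNorm_sub_le hρ J (C 3 * X) (X ^ 3 : PowerSeries ℝ)
  have h2 := truncNorm_X_le (R := ℝ) hρ J
  have h3 := truncNorm_X_pow_le (R := ℝ) hρ J 3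
  rw [truncNorm_C_mul, ← h] at h1
  norm_num at h1 h3
  linarith

theorem truncNorm_one_sub_denom_succ_le (m J : ℕ) :
    truncNorm (1 / 3) J (C 1 - denom (m + 1)) ≤ 163 / 243 := by
  have hρ : (0 : ℝ) ≤ 1 / 3 := by norm_num
  have h : C 1 - denom (m + 1) = -(X ^ (m + 1) * (1 - C 3 * X) + X ^ (2 * (m + 1) + 3)) := by
    rw [denom, map_ofNat, map_one]
    ring
  have hlin : truncNorm (1 / 3) J (1 - C 3 * X : PowerSeries ℝ) ≤ 2 := by
    have h1 := truncNorm_sub_le hρ J 1 (C 3 * X : PowerSeries ℝ)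
    have h2 := truncNorm_X_le (R := ℝ) hρ J
    have h3 := truncNorm_one_le (R := ℝ) hρ J
    rw [truncNorm_C_mul] at h1
    norm_num at h1
    linarith
  have hpow : (1 / 3 : ℝ) ^ (m + 1) ≤ (1 / 3) ^ 1 :=
    pow_le_pow_of_le_one hρ (by norm_num) (by omega)
  have hpow' : (1 / 3 : ℝ) ^ (2 * (m + 1) + 3) ≤ (1 / 3) ^ 5 :=
    pow_le_pow_of_le_one hρ (by norm_num) (by omega)
  rw [h, truncNorm_neg]
  calc truncNorm (1 / 3) J (X ^ (m + 1) * (1 - C 3 * X) + X ^ (2 * (m + 1) + 3))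
      ≤ (1 / 3) ^ 1 * 2 + (1 / 3) ^ 5 := (truncNorm_add_le hρ J _ _).trans (add_le_add
        (truncNorm_mul_le_of_le hρ ((truncNorm_X_pow_le hρ J _).trans hpow) hlin)
        ((truncNorm_X_pow_le hρ J _).trans hpow'))
    _ = 163 / 243 := by norm_num

theorem truncNorm_inv_denom_le (m J : ℕ) : truncNorm (1 / 3) J (denom m)⁻¹ ≤ 4 := by
  have hρ : (0 : ℝ) ≤ 1 / 3 := by norm_num
  rcases m with _ | m
  · refine (truncNorm_le_of_mul_eq_one hρ (denom_mul_inv_cancel 0)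
      (truncNorm_two_sub_denom_zero_le J) ?_).trans ?_ <;> norm_num
  · refine (truncNorm_le_of_mul_eq_one hρ (denom_mul_inv_cancel (m + 1))
      (truncNorm_one_sub_denom_succ_le m J) ?_).trans ?_ <;> norm_num

theorem truncNorm_X_pow_mul_mainFactor_le (m J : ℕ) :
    truncNorm (1 / 3) J (X ^ m * mainFactor m) ≤ 8 * (1 / 3) ^ m := by
  have hρ : (0 : ℝ) ≤ 1 / 3 := by norm_num
  have h1 : truncNorm (1 / 3) J (1 - X : PowerSeries ℝ) ≤ 1 + 1 / 3 := by
    simpa using truncNorm_one_sub_X_pow_le 1 J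
  have h := truncNorm_mul_le_of_le hρ (truncNorm_X_pow_le hρ J m) (truncNorm_mul_le_of_le hρ
    (truncNorm_mul_le_of_le hρ h1 h1) (truncNorm_inv_denom_le m J))
  rw [mainFactor, sq]
  refine h.trans ?_
  rw [mul_comm]
  gcongr
  norm_num

theorem truncNorm_X_pow_mul_regularPart_le (m J : ℕ) :
    truncNorm (1 / 3) J (X ^ m * regularPart m) ≤ 4 * (1 / 3) ^ m := by
  have hρ : (0 : ℝ) ≤ 1 / 3 := by norm_num
  have h1 : truncNorm (1 / 3) J (1 - X : PowerSeries ℝ) ≤ 1 + 1 / 3 := by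
    simpa using truncNorm_one_sub_X_pow_le 1 J
  have h2 : truncNorm (1 / 3) J (1 - X ^ (m + 2) : PowerSeries ℝ) ≤ 1 + 1 :=
    (truncNorm_one_sub_X_pow_le _ J).trans (by gcongr; exact pow_le_one₀ hρ (by norm_num))
  have h := truncNorm_mul_le_of_le hρ (truncNorm_X_pow_le hρ J m) (truncNorm_mul_le_of_le hρ
    (truncNorm_mul_le_of_le hρ (truncNorm_mul_le_of_le hρ (truncNorm_X_le hρ J) h1) h2)
    (truncNorm_inv_denom_le m J))
  rw [regularPart, mul_neg, truncNorm_neg]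
  refine h.trans ?_
  rw [mul_comm]
  gcongr
  norm_num

end PlaneTree

theorem le_add_mul_pow_of_sub_le {a : ℕ → ℝ} {c : ℝ} {d N : ℕ} (hc : 0 ≤ c)
    (h : ∀ j < N, a (j + 1) - a j ≤ c * ((j : ℝ) + 2) ^ d) :
    a N ≤ a 0 + c * ((N : ℝ) + 1) ^ (d + 1) := by
  have hterm : ∀ j ∈ Finset.range N, a (j + 1) - a j ≤ c * ((N : ℝ) + 1) ^ d := fun j hj => by
    rw [Finset.mem_range] at hj
    have hjN : (j : ℝ) + 1 ≤ N := by exact_mod_cast hj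
    refine (h j hj).trans ?_
    gcongr c * ?_ ^ d
    linarith
  have hsum := Finset.sum_le_card_nsmul _ _ _ hterm
  rw [Finset.sum_range_sub, Finset.card_range, nsmul_eq_mul] at hsum
  have hpow : (N : ℝ) * (c * ((N : ℝ) + 1) ^ d) ≤ c * ((N : ℝ) + 1) ^ (d + 1) := by
    rw [pow_succ, ← mul_assoc c, mul_comm]
    gcongr
    linarith
  linarith

namespace PlaneTree

open PowerSeries

/-- The number of plane trees with `n` vertices, as a real number. -/
noncomputable def treeCount (n : ℕ) : ℝ := coeff n (tailGenFun 0)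

theorem treeCount_zero : treeCount 0 = 0 := by
  rw [treeCount, coeff_zero_eq_constantCoeff_apply, constantCoeff_tailGenFun_zero]

theorem treeCount_succ (n : ℕ) : treeCount (n + 1) = catalan n := coeff_succ_tailGenFun_zero n

theorem treeCount_pos {n : ℕ} (hn : 1 ≤ n) : 0 < treeCount n := by
  obtain ⟨p, rfl⟩ := Nat.exists_eq_add_of_le' hn
  rw [treeCount_succ, Nat.cast_pos]
  refine pos_of_mul_pos_right (a := p + 1) ?_ (Nat.zero_le _)
  rw [succ_mul_catalan_eq_centralBinom]
  exact Nat.centralBinom_pos p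

theorem add_two_mul_treeCount (p : ℕ) :
    ((p : ℝ) + 2) * treeCount (p + 2) = (4 * p + 2) * treeCount (p + 1) := by
  rw [treeCount_succ, treeCount_succ]
  have h := Nat.succ_mul_centralBinom_succ p
  rw [← succ_mul_catalan_eq_centralBinom, ← succ_mul_catalan_eq_centralBinom] at h
  have hreal : ((p : ℝ) + 1) * ((p + 1 + 1) * catalan (p + 1)) =
      2 * (2 * p + 1) * ((p + 1) * catalan p) := by exact_mod_cast h
  refine mul_left_cancel₀ (Nat.cast_add_one_ne_zero p) ?_
  linear_combination hreal

/-- The normalised ratio of the numbers of plane trees with `n - j` and with `n` vertices. It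
vanishes for `j ≥ n`, the truncated `n - j` then being `0`. -/
noncomputable def countRatio (n j : ℕ) : ℝ := 4 ^ j * treeCount (n - j) / treeCount n

theorem countRatio_zero {n : ℕ} (hn : 1 ≤ n) : countRatio n 0 = 1 := by
  simp [countRatio, (treeCount_pos hn).ne']

theorem countRatio_of_le {n j : ℕ} (h : n ≤ j) : countRatio n j = 0 := by
  rw [countRatio, Nat.sub_eq_zero_of_le h, treeCount_zero, mul_zero, zero_div]

theorem countRatio_succ_mul {n j : ℕ} (h : j + 2 ≤ n) :
    countRatio n (j + 1) * ((n : ℝ) - j - 3 / 2) = countRatio n j * (n - j) := by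
  obtain ⟨p, rfl⟩ : ∃ p, n = p + 2 + j := ⟨n - j - 2, by omega⟩
  rw [countRatio, countRatio, show p + 2 + j - (j + 1) = p + 1 by omega, Nat.add_sub_cancel]
  have hp := (treeCount_pos (show 1 ≤ p + 2 + j by omega)).ne'
  field_simp
  push_cast
  linear_combination (-2 * (4 : ℝ) ^ j) * add_two_mul_treeCount p

theorem countRatio_succ_sub {n j : ℕ} (h : j + 2 ≤ n) :
    countRatio n (j + 1) - countRatio n j = 3 / 2 * (countRatio n (j + 1) / (n - j)) := by
  have hn : (j : ℝ) + 2 ≤ n := by exact_mod_cast h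
  have hne : (n : ℝ) - j ≠ 0 := by linarith
  field_simp
  linear_combination 2 * countRatio_succ_mul h

theorem le_countRatio {n j : ℕ} (h : j + 1 ≤ n) : 1 + 3 / 2 * (j / n : ℝ) ≤ countRatio n j := by
  induction j with
  | zero => simp [countRatio_zero h]
  | succ j ih =>
    have hj := ih (by omega)
    have hn : (j : ℝ) + 2 ≤ n := by exact_mod_cast h
    have hpos : (0 : ℝ) < n - j := by linarith
    have hfrac : (0 : ℝ) ≤ j / n := by positivity
    have hone : 1 ≤ countRatio n (j + 1) := by
      have := countRatio_succ_mul h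
      nlinarith
    have hstep : 1 / (n : ℝ) ≤ countRatio n (j + 1) / (n - j) := by
      gcongr
      linarith [j.cast_nonneg (α := ℝ)]
    have := countRatio_succ_sub h
    push_cast
    rw [add_div]
    linarith

theorem one_le_countRatio {n j : ℕ} (h : j + 1 ≤ n) : 1 ≤ countRatio n j := by
  have hfrac : (0 : ℝ) ≤ j / n := by positivity
  linarith [le_countRatio h]

theorem countRatio_mul_sq_le {n j : ℕ} (h : j + 1 ≤ n) :
    countRatio n j * ((n : ℝ) - j) ^ 2 ≤ (n : ℝ) ^ 2 := by
  induction j with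
  | zero => simp [countRatio_zero h]
  | succ j ih =>
    refine le_trans ?_ (ih (by omega))
    have hn : (j : ℝ) + 2 ≤ n := by exact_mod_cast h
    have hx := one_le_countRatio (show j + 1 ≤ n by omega)
    have hpos : (0 : ℝ) < n - j - 3 / 2 := by linarith
    rw [← mul_le_mul_iff_left₀ hpos]
    have hgap : (0 : ℝ) ≤ countRatio n j * (n - j) * (((n : ℝ) - j) - 2) :=
      mul_nonneg (mul_nonneg (by linarith) (by linarith)) (by linarith)
    push_cast
    linear_combination hgap / 2 + ((n : ℝ) - (j + 1)) ^ 2 * countRatio_succ_mul h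

theorem one_div_sub_le {n j : ℕ} (h : j + 1 ≤ n) : 1 / ((n : ℝ) - j) ≤ (1 + j) / n := by
  have hn : (j : ℝ) + 1 ≤ n := by exact_mod_cast h
  have hprod : (0 : ℝ) ≤ j * (n - 1 - j) := mul_nonneg (by positivity) (by linarith)
  rw [div_le_div_iff₀ (by linarith) (by linarith)]
  linarith

theorem countRatio_le_sq {n j : ℕ} (h : j + 1 ≤ n) : countRatio n j ≤ (1 + j) ^ 2 := by
  have hn : (j : ℝ) + 1 ≤ n := by exact_mod_cast h
  have hpos : (0 : ℝ) < n - j := by linarith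
  calc countRatio n j ≤ (n * (1 / (n - j))) ^ 2 := by
        rw [mul_one_div, div_pow, le_div_iff₀ (by positivity)]
        exact countRatio_mul_sq_le h
    _ ≤ (n * ((1 + j) / n)) ^ 2 := by
        have := one_div_sub_le h
        gcongr
    _ = (1 + j) ^ 2 := by rw [mul_div_cancel₀ _ (by linarith)]

theorem countRatio_sub_one_le {n j : ℕ} (h : j + 1 ≤ n) :
    countRatio n j - 1 ≤ 3 / 2 / n * (j + 1) ^ 4 := by
  have hsum := le_add_mul_pow_of_sub_le (a := countRatio n) (c := 3 / 2 / n) (d := 3) (N := j)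
    (by positivity) fun i hi => ?_
  · rw [countRatio_zero (by omega)] at hsum
    linarith
  · have hx := countRatio_le_sq (show (i + 1) + 1 ≤ n by omega)
    have hn : (i : ℝ) + 2 ≤ n := by exact_mod_cast (show i + 2 ≤ n by omega)
    calc countRatio n (i + 1) - countRatio n i
        = 3 / 2 * (countRatio n (i + 1) * (1 / (n - i))) := by
          rw [countRatio_succ_sub (by omega), mul_one_div]
      _ ≤ 3 / 2 * ((1 + (i + 1 : ℕ)) ^ 2 * ((1 + i) / n)) := by
          have := one_div_sub_le (show i + 1 ≤ n by omega)
          have : (0 : ℝ) ≤ 1 / (n - i) := one_div_nonneg.2 (by linarith)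
          gcongr
      _ = 3 / 2 / n * ((i + 2) ^ 2 * (i + 1)) := by push_cast; ring
      _ ≤ 3 / 2 / n * ((i + 2) ^ 2 * (i + 2)) := by gcongr; norm_num
      _ = 3 / 2 / n * (i + 2) ^ 3 := by ring

theorem countRatio_sub_le {n j : ℕ} (h : j + 1 ≤ n) :
    countRatio n j - (1 + 3 / 2 * (j / n : ℝ)) ≤ 4 / n ^ 2 * (j + 1) ^ 6 := by
  have hsum := le_add_mul_pow_of_sub_le
    (a := fun i => countRatio n i - 3 / 2 * (i / n : ℝ)) (c := 4 / (n : ℝ) ^ 2) (d := 5) (N := j)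
    (by positivity) fun i hi => ?_
  · rw [countRatio_zero (by omega), Nat.cast_zero, zero_div, mul_zero] at hsum
    linarith
  · have hn : (i : ℝ) + 2 ≤ n := by exact_mod_cast (show i + 2 ≤ n by omega)
    have hx := countRatio_sub_one_le (show (i + 1) + 1 ≤ n by omega)
    have hd := one_div_sub_le (show i + 1 ≤ n by omega)
    have hd0 : (0 : ℝ) ≤ 1 / (n - i) := one_div_nonneg.2 (by linarith)
    have hn0 : (n : ℝ) ≠ 0 := by linarith
    have hni : (n : ℝ) - i ≠ 0 := by linarith
    calc countRatio n (i + 1) - 3 / 2 * ((i + 1 : ℕ) / n : ℝ) -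
          (countRatio n i - 3 / 2 * (i / n : ℝ))
        = 3 / 2 * ((countRatio n (i + 1) - 1) * (1 / (n - i)) + i / n * (1 / (n - i))) := by
          have := countRatio_succ_sub (show i + 2 ≤ n by omega)
          push_cast
          field_simp at this ⊢
          linear_combination n * this
      _ ≤ 3 / 2 * (3 / 2 / n * ((i + 1 : ℕ) + 1) ^ 4 * ((1 + i) / n) + i / n * ((1 + i) / n)) := by
          gcongr
      _ ≤ 3 / 2 * (3 / 2 / n * (i + 2) ^ 4 * ((i + 2) / n) + (i + 2) / n * ((i + 2) / n)) := by
          push_cast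
          gcongr ?_ * (?_ * ?_ ^ 4 * (?_ / _) + ?_ / _ * (?_ / _)) <;> linarith
      _ = 9 / 4 / n ^ 2 * (i + 2) ^ 5 + 3 / 2 / n ^ 2 * (i + 2) ^ 2 := by ring
      _ ≤ 9 / 4 / n ^ 2 * (i + 2) ^ 5 + 3 / 2 / n ^ 2 * (i + 2) ^ 5 := by
          gcongr
          · linarith
          · norm_num
      _ = 15 / 4 / n ^ 2 * (i + 2) ^ 5 := by ring
      _ ≤ 4 / n ^ 2 * (i + 2) ^ 5 := by gcongr; norm_num

theorem abs_countRatio_sub_le {n : ℕ} (hn : 1 ≤ n) (j : ℕ) :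
    |countRatio n j - (1 + 3 / 2 * (j / n : ℝ))| ≤ 4 / n ^ 2 * (j + 1) ^ 6 := by
  have hn1 : (1 : ℝ) ≤ n := by exact_mod_cast hn
  rcases le_or_gt n j with h | h
  · have hnj : (n : ℝ) ≤ j := by exact_mod_cast h
    rw [countRatio_of_le h, zero_sub, abs_neg, abs_of_nonneg (by positivity),
      div_mul_eq_mul_div (4 : ℝ), le_div_iff₀ (by positivity)]
    calc (1 + 3 / 2 * (j / n : ℝ)) * n ^ 2 ≤ (2 * (j + 1)) * ((j : ℝ) + 1) ^ 2 := by
          have : (j / n : ℝ) ≤ j := div_le_self (by positivity) hn1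
          gcongr <;> linarith
      _ = 2 * ((j : ℝ) + 1) ^ 3 := by ring
      _ ≤ 4 * ((j : ℝ) + 1) ^ 6 := by
          gcongr
          · norm_num
          · linarith
          · norm_num
  · rw [abs_of_nonneg (by linarith [le_countRatio h])]
    exact countRatio_sub_le h

theorem four_pow_le_treeCount {n : ℕ} (hn : 1 ≤ n) : (4 : ℝ) ^ n ≤ 4 * n ^ 2 * treeCount n := by
  obtain ⟨p, rfl⟩ := Nat.exists_eq_add_of_le' hn
  have h := countRatio_le_sq (le_refl (p + 1))
  rw [countRatio, Nat.add_sub_cancel_left, treeCount_succ 0, catalan_zero, Nat.cast_one, mul_one,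
    div_le_iff₀ (treeCount_pos hn)] at h
  push_cast
  rw [pow_succ]
  linarith

end PlaneTree

/-- `f` converges absolutely at `r` and takes the value `v` there. -/
def HasValueAt {R : Type*} [NormedCommRing R] (f : PowerSeries R) (r v : R) : Prop :=
  (Summable fun j => ‖PowerSeries.coeff j f * r ^ j‖) ∧
    HasSum (fun j => PowerSeries.coeff j f * r ^ j) v

namespace HasValueAt

open PowerSeries

variable {R : Type*} [NormedCommRing R] {r v w : R} {f g : PowerSeries R}

theorem unique (hf : HasValueAt f r v) (hf' : HasValueAt f r w) : v = w :=
  hf.2.unique hf'.2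

theorem neg (hf : HasValueAt f r v) : HasValueAt (-f) r (-v) :=
  ⟨by simpa using hf.1, by simpa using hf.2.neg⟩

theorem add (hf : HasValueAt f r v) (hg : HasValueAt g r w) : HasValueAt (f + g) r (v + w) := by
  constructor
  · refine Summable.of_nonneg_of_le (fun _ => norm_nonneg _) (fun j => ?_) (hf.1.add hg.1)
    rw [map_add, add_mul]
    exact norm_add_le _ _
  · simpa [add_mul] using hf.2.add hg.2

theorem sub (hf : HasValueAt f r v) (hg : HasValueAt g r w) : HasValueAt (f - g) r (v - w) := by
  rw [sub_eq_add_neg, sub_eq_add_neg]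
  exact hf.add hg.neg

theorem mul [CompleteSpace R] (hf : HasValueAt f r v) (hg : HasValueAt g r w) :
    HasValueAt (f * g) r (v * w) := by
  have hcoeff : ∀ n, coeff n (f * g) * r ^ n = ∑ p ∈ Finset.HasAntidiagonal.antidiagonal n,
      (coeff p.1 f * r ^ p.1) * (coeff p.2 g * r ^ p.2) := fun n => by
    rw [coeff_mul, Finset.sum_mul]
    refine Finset.sum_congr rfl fun p hp => ?_
    rw [← Finset.HasAntidiagonal.mem_antidiagonal.1 hp, pow_add, mul_mul_mul_comm]
  have hsummable := summable_norm_sum_mul_antidiagonal_of_summable_norm hf.1 hg.1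
  have htsum := tsum_mul_tsum_eq_tsum_sum_antidiagonal_of_summable_norm hf.1 hg.1
  simp only [← hcoeff, hf.2.tsum_eq, hg.2.tsum_eq] at hsummable htsum
  exact ⟨hsummable, htsum ▸ hsummable.of_norm.hasSum⟩

theorem C_mul_X_pow (a r : R) (m : ℕ) : HasValueAt (C a * X ^ m) r (a * r ^ m) := by
  have hne : ∀ j, j ≠ m → coeff j (C a * X ^ m) * r ^ j = 0 := fun j hj => by
    simp [coeff_X_pow, hj]
  constructor
  · exact summable_of_ne_finset_zero (s := {m}) fun j hj => by
      rw [hne j (by simpa using hj), norm_zero]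
  · simpa using hasSum_single (f := fun j => coeff j (C a * X ^ m) * r ^ j) m hne

theorem X_pow (r : R) (m : ℕ) : HasValueAt (X ^ m) r (r ^ m) := by
  simpa using C_mul_X_pow 1 r m

theorem X (r : R) : HasValueAt X r r := by
  simpa using X_pow r 1

theorem C (a r : R) : HasValueAt (C a) r a := by
  simpa using C_mul_X_pow a r 0

theorem one (r : R) : HasValueAt 1 r 1 := by
  simpa using C 1 r

end HasValueAt

/-- The Euler derivation `X d/dX`. -/
noncomputable def eulerDerivation (R : Type*) [CommSemiring R] :
    Derivation R (PowerSeries R) (PowerSeries R) :=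
  (PowerSeries.X : PowerSeries R) • PowerSeries.derivative R

section eulerDerivation

open PowerSeries

variable {R : Type*} [CommSemiring R]

theorem coeff_eulerDerivation (n : ℕ) (f : PowerSeries R) :
    coeff n (eulerDerivation R f) = n * coeff n f := by
  rw [eulerDerivation, Derivation.smul_apply, smul_eq_mul]
  rcases n with _ | n
  · simp
  · simp [coeff_succ_X_mul, coeff_derivative, mul_comm]

theorem eulerDerivation_C (a : R) : eulerDerivation R (C a) = 0 :=
  (eulerDerivation R).map_algebraMap a

theorem eulerDerivation_X_pow (m : ℕ) : eulerDerivation R (X ^ m) = C (m : R) * X ^ m := by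
  ext n
  rw [coeff_eulerDerivation, coeff_C_mul, coeff_X_pow]
  split_ifs with h <;> simp [h]

theorem eulerDerivation_X : eulerDerivation R X = X := by
  simpa using eulerDerivation_X_pow (R := R) 1

end eulerDerivation

theorem exists_add_one_pow_mul_pow_le {r ρ : ℝ} (d : ℕ) (hr : 0 ≤ r) (h : r < ρ) :
    ∃ B, ∀ j : ℕ, ((j : ℝ) + 1) ^ d * r ^ j ≤ B * ρ ^ j := by
  have hshift : (fun j : ℕ => ((j : ℝ) + 1) ^ d) =O[atTop] fun j : ℕ => (j : ℝ) ^ d := by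
    refine IsBigO.pow (IsBigO.of_bound 2 ?_) d
    filter_upwards [eventually_ge_atTop 1] with j hj
    have hj1 : (1 : ℝ) ≤ j := by exact_mod_cast hj
    rw [Real.norm_of_nonneg (by positivity), Real.norm_of_nonneg (by positivity)]
    linarith
  have hO := (hshift.mul (isBigO_refl (fun j : ℕ => r ^ j) atTop)).trans
    (isLittleO_pow_const_mul_const_pow_const_pow_of_norm_lt d
      (by rwa [Real.norm_of_nonneg hr])).isBigO
  obtain ⟨B, -, hB⟩ := bound_of_isBigO_nat_atTop hO
  have hρ : 0 < ρ := hr.trans_lt h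
  refine ⟨B, fun j => ?_⟩
  have hj := hB (pow_ne_zero j hρ.ne')
  rwa [Real.norm_of_nonneg (by positivity), Real.norm_of_nonneg (by positivity)] at hj

section HasValueAt

open PowerSeries

variable {R : Type*} [NormedCommRing R] [NormOneClass R] [CompleteSpace R] {f : PowerSeries R}
  {r : R} {ρ K : ℝ}

theorem exists_hasValueAt_of_truncNorm_le (hr : ‖r‖ ≤ ρ) (h : ∀ J, truncNorm ρ J f ≤ K) :
    ∃ v, HasValueAt f r v := by
  have hρ : 0 ≤ ρ := (norm_nonneg r).trans hr
  have hsum : Summable fun j => ‖coeff j f * r ^ j‖ :=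
    (summable_norm_coeff_mul_pow hρ h).of_nonneg_of_le (fun _ => norm_nonneg _) fun j =>
      (norm_mul_le _ _).trans (by gcongr; exact (norm_pow_le r j).trans (by gcongr))
  exact ⟨_, hsum, hsum.of_norm.hasSum⟩

theorem exists_hasValueAt_eulerDerivation_of_truncNorm_le (hr : ‖r‖ < ρ)
    (h : ∀ J, truncNorm ρ J f ≤ K) : ∃ v, HasValueAt (eulerDerivation R f) r v := by
  obtain ⟨B, hB⟩ := exists_add_one_pow_mul_pow_le 1 (norm_nonneg r) hr
  have hρ : 0 ≤ ρ := (norm_nonneg r).trans hr.le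
  have hsum : Summable fun j => ‖coeff j (eulerDerivation R f) * r ^ j‖ := by
    refine ((summable_norm_coeff_mul_pow hρ h).mul_left B).of_nonneg_of_le
      (fun _ => norm_nonneg _) fun j => ?_
    rw [coeff_eulerDerivation]
    calc ‖(j : R) * coeff j f * r ^ j‖ ≤ j * ‖coeff j f‖ * ‖r‖ ^ j := by
          refine (norm_mul_le _ _).trans ?_
          gcongr
          · refine (norm_mul_le _ _).trans ?_
            gcongr
            simpa using Nat.norm_cast_le (α := R) j
          · exact norm_pow_le r j
      _ ≤ ‖coeff j f‖ * (((j : ℝ) + 1) ^ 1 * ‖r‖ ^ j) := by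
          rw [pow_one, mul_comm (j : ℝ), mul_assoc]
          gcongr
          linarith
      _ ≤ ‖coeff j f‖ * (B * ρ ^ j) := mul_le_mul_of_nonneg_left (hB j) (norm_nonneg _)
      _ = B * (‖coeff j f‖ * ρ ^ j) := by ring
  exact ⟨_, hsum, hsum.of_norm.hasSum⟩

end HasValueAt

namespace PlaneTree

open PowerSeries

theorem hasValueAt_denom (m : ℕ) :
    HasValueAt (denom m) (1 / 4) ((1 + (1 / 4) ^ m / 8) ^ 2) := by
  have hX := HasValueAt.X (1 / 4 : ℝ)
  have h := ((HasValueAt.one _).add ((HasValueAt.X_pow _ m).mul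
    ((HasValueAt.one _).sub ((HasValueAt.C 3 _).mul hX)))).add (HasValueAt.X_pow _ (2 * m + 3))
  convert h using 1
  · rw [denom, map_ofNat]
  · ring

theorem hasValueAt_eulerDerivation_denom (m : ℕ) :
    HasValueAt (eulerDerivation ℝ (denom m)) (1 / 4)
      (m / 4 * (1 / 4) ^ m - 3 / 4 * (1 / 4) ^ m + (2 * m + 3) / 64 * ((1 / 4) ^ m) ^ 2) := by
  have hX := HasValueAt.X (1 / 4 : ℝ)
  have hq := HasValueAt.X_pow (1 / 4 : ℝ) m
  have h := (((HasValueAt.C (m : ℝ) _).mul hq).mul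
    ((HasValueAt.one _).sub ((HasValueAt.C 3 _).mul hX))).sub
    (hq.mul ((HasValueAt.C 3 _).mul hX)) |>.add
    ((HasValueAt.C ((2 * m + 3 : ℕ) : ℝ) _).mul (HasValueAt.X_pow _ (2 * m + 3)))
  convert h using 1
  · rw [denom, ← map_ofNat (PowerSeries.C (R := ℝ)) 3]
    simp only [map_add, map_sub, Derivation.leibniz, Derivation.map_one_eq_zero, eulerDerivation_C,
      eulerDerivation_X, eulerDerivation_X_pow, smul_eq_mul]
    ring
  · push_cast
    ring

theorem X_pow_mul_mainFactor_mul_denom (m : ℕ) :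
    X ^ m * mainFactor m * denom m = X ^ m * (1 - X) ^ 2 := by
  rw [mainFactor]
  linear_combination (X ^ m * (1 - X) ^ 2) * denom_mul_inv_cancel m

theorem eulerDerivation_mainFactor_mul_denom (m : ℕ) :
    eulerDerivation ℝ (X ^ m * mainFactor m) * denom m +
        X ^ m * mainFactor m * eulerDerivation ℝ (denom m) =
      C (m : ℝ) * X ^ m * (1 - X) ^ 2 - C 2 * X ^ m * X * (1 - X) := by
  have h := congrArg (eulerDerivation ℝ) (X_pow_mul_mainFactor_mul_denom m)
  simp only [sq (1 - X : PowerSeries ℝ), Derivation.leibniz, map_sub, Derivation.map_one_eq_zero,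
    eulerDerivation_X, eulerDerivation_X_pow, smul_eq_mul] at h ⊢
  rw [map_ofNat]
  linear_combination h

theorem one_div_four_pow_eq (m : ℕ) : (1 / 4 : ℝ) ^ m = 16 / 4 ^ (m + 2) := by
  rw [pow_add, one_div_pow]
  field_simp
  norm_num

theorem hasValueAt_X_pow_mul_mainFactor (m : ℕ) :
    HasValueAt (X ^ m * mainFactor m) (1 / 4) (term0 (m + 2)) := by
  obtain ⟨v, hv⟩ := exists_hasValueAt_of_truncNorm_le (r := (1 / 4 : ℝ)) (by norm_num)
    (truncNorm_X_pow_mul_mainFactor_le m)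
  have hX := HasValueAt.X (1 / 4 : ℝ)
  have hone := (HasValueAt.one (1 / 4 : ℝ)).sub hX
  have h := hv.mul (hasValueAt_denom m)
  rw [X_pow_mul_mainFactor_mul_denom, sq (1 - X)] at h
  have heq := h.unique ((HasValueAt.X_pow _ m).mul (hone.mul hone))
  rw [one_div_four_pow_eq] at heq
  convert hv
  rw [term0, div_eq_iff (by positivity)]
  field_simp at heq
  linear_combination -heq / 1024

theorem hasValueAt_eulerDerivation_X_pow_mul_mainFactor (m : ℕ) :
    HasValueAt (eulerDerivation ℝ (X ^ m * mainFactor m)) (1 / 4) (2 / 3 * term1 (m + 2)) := by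
  obtain ⟨w, hw⟩ := exists_hasValueAt_eulerDerivation_of_truncNorm_le (r := (1 / 4 : ℝ))
    (by norm_num) (truncNorm_X_pow_mul_mainFactor_le m)
  have hX := HasValueAt.X (1 / 4 : ℝ)
  have hq := HasValueAt.X_pow (1 / 4 : ℝ) m
  have hone := (HasValueAt.one (1 / 4 : ℝ)).sub hX
  have h := (hw.mul (hasValueAt_denom m)).add
    ((hasValueAt_X_pow_mul_mainFactor m).mul (hasValueAt_eulerDerivation_denom m))
  rw [eulerDerivation_mainFactor_mul_denom, sq (1 - X)] at h
  have heq := h.unique ((((HasValueAt.C (m : ℝ) _).mul hq).mul (hone.mul hone)).sub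
    ((((HasValueAt.C 2 _).mul hq).mul hX).mul hone))
  rw [one_div_four_pow_eq, term0] at heq
  convert hw
  rw [term1, ← mul_div_assoc, div_eq_iff (by positivity), mul_comm 2 (m + 2), pow_mul]
  push_cast
  field_simp at heq
  linear_combination -1 / 32768 * heq

section transfer

variable {S : PowerSeries ℝ} {ρ B K : ℝ} {n : ℕ}

theorem hasSum_coeff_mul_countRatio (S : PowerSeries ℝ) (hn : 1 ≤ n) :
    HasSum (fun j => coeff j S * (1 / 4) ^ j * countRatio n j)
      (coeff n (S * tailGenFun 0) / treeCount n) := by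
  have heq : coeff n (S * tailGenFun 0) / treeCount n =
      ∑ j ∈ Finset.range (n + 1), coeff j S * (1 / 4) ^ j * countRatio n j := by
    have hT := (treeCount_pos hn).ne'
    rw [coeff_mul, Finset.Nat.sum_antidiagonal_eq_sum_range_succ
      (fun i j => coeff i S * coeff j (tailGenFun 0)), Finset.sum_div]
    refine Finset.sum_congr rfl fun j _ => ?_
    rw [countRatio, one_div_pow, ← treeCount]
    field_simp
  rw [heq]
  refine hasSum_sum_of_ne_finset_zero fun j hj => ?_
  rw [Finset.mem_range] at hj
  rw [countRatio_of_le (by omega), mul_zero]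

theorem hasSum_coeff_mul_first_order {v w : ℝ} (hv : HasValueAt S (1 / 4) v)
    (hw : HasValueAt (eulerDerivation ℝ S) (1 / 4) w) (n : ℕ) :
    HasSum (fun j : ℕ => coeff j S * (1 / 4) ^ j * (1 + 3 / 2 * (j / n : ℝ)))
      (v + 3 / 2 * w / n) := by
  have hterm : (fun j : ℕ => coeff j S * (1 / 4) ^ j * (1 + 3 / 2 * (j / n : ℝ))) = fun j =>
      coeff j S * (1 / 4) ^ j + 3 / 2 / n * (coeff j (eulerDerivation ℝ S) * (1 / 4) ^ j) := by
    funext j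
    rw [coeff_eulerDerivation]
    ring
  rw [hterm, ← div_mul_eq_mul_div]
  exact hv.2.add (hw.2.mul_left (3 / 2 / (n : ℝ)))

/-- Transfer: the factor `4⁻ʲ (1 + 3 j / (2 n))`, which approximates `tₙ₋ⱼ / tₙ`, turns the
convolution with the tree numbers into the value and the derivative at the singularity `1 / 4`. -/
theorem abs_coeff_mul_tailGenFun_zero_div_sub_le (hρ : 0 ≤ ρ)
    (hB : ∀ j : ℕ, ((j : ℝ) + 1) ^ 6 * (1 / 4) ^ j ≤ B * ρ ^ j)
    (hS : ∀ J, truncNorm ρ J S ≤ K) {v w : ℝ} (hv : HasValueAt S (1 / 4) v)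
    (hw : HasValueAt (eulerDerivation ℝ S) (1 / 4) w) (hn : 1 ≤ n) :
    |coeff n (S * tailGenFun 0) / treeCount n - (v + 3 / 2 * w / n)| ≤ 4 * B * K / n ^ 2 := by
  have hB0 : 0 ≤ B := by linarith [show 1 ≤ B by simpa using hB 0]
  have hterm : ∀ j : ℕ, ‖coeff j S * (1 / 4) ^ j * countRatio n j -
      coeff j S * (1 / 4) ^ j * (1 + 3 / 2 * (j / n : ℝ))‖ ≤
      4 * B / n ^ 2 * (‖coeff j S‖ * ρ ^ j) := fun j => by
    rw [← mul_sub, norm_mul, norm_mul, norm_pow,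
      Real.norm_of_nonneg (by norm_num : (0 : ℝ) ≤ 1 / 4)]
    calc ‖coeff j S‖ * (1 / 4) ^ j * |countRatio n j - (1 + 3 / 2 * (j / n : ℝ))|
        ≤ ‖coeff j S‖ * (1 / 4) ^ j * (4 / n ^ 2 * (j + 1) ^ 6) := by
          gcongr
          exact abs_countRatio_sub_le hn j
      _ = 4 / n ^ 2 * ‖coeff j S‖ * ((j + 1) ^ 6 * (1 / 4) ^ j) := by ring
      _ ≤ 4 / n ^ 2 * ‖coeff j S‖ * (B * ρ ^ j) := by
          gcongr _ * ?_
          exact hB j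
      _ = 4 * B / n ^ 2 * (‖coeff j S‖ * ρ ^ j) := by ring
  have hsum := (hasSum_coeff_mul_countRatio S hn).sub (hasSum_coeff_mul_first_order hv hw n)
  rw [← hsum.tsum_eq, ← Real.norm_eq_abs]
  refine (tsum_of_norm_bounded
    ((summable_norm_coeff_mul_pow hρ hS).mul_left _).hasSum hterm).trans ?_
  rw [tsum_mul_left, mul_div_right_comm (4 * B) K]
  exact mul_le_mul_of_nonneg_left (tsum_norm_coeff_mul_pow_le hρ hS) (by positivity)

theorem abs_coeff_div_treeCount_le (hρ : 0 ≤ ρ)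
    (hB : ∀ j : ℕ, ((j : ℝ) + 1) ^ 4 * (1 / 4) ^ j ≤ B * ρ ^ j)
    (hS : ∀ J, truncNorm ρ J S ≤ K) (hn : 1 ≤ n) :
    |coeff n S / treeCount n| ≤ 4 * B * K / n ^ 2 := by
  have hT := treeCount_pos hn
  have hB0 : 0 ≤ B := by linarith [show 1 ≤ B by simpa using hB 0]
  have hK : 0 ≤ K := (truncNorm_nonneg hρ 0 S).trans (hS 0)
  have hn0 : (0 : ℝ) < n := by exact_mod_cast hn
  have hgeom : |coeff n S| * ((n : ℝ) ^ 4 * (1 / 4) ^ n) ≤ B * K :=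
    calc |coeff n S| * ((n : ℝ) ^ 4 * (1 / 4) ^ n)
        ≤ |coeff n S| * (((n : ℝ) + 1) ^ 4 * (1 / 4) ^ n) := by gcongr; linarith
      _ ≤ |coeff n S| * (B * ρ ^ n) := mul_le_mul_of_nonneg_left (hB n) (abs_nonneg _)
      _ = B * (‖coeff n S‖ * ρ ^ n) := by rw [Real.norm_eq_abs]; ring
      _ ≤ B * K := by gcongr; exact norm_coeff_mul_pow_le hρ hS n
  rw [abs_div, abs_of_pos hT, div_le_div_iff₀ hT (by positivity)]
  refine le_of_mul_le_mul_right ?_ (pow_pos hn0 2)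
  calc |coeff n S| * (n : ℝ) ^ 2 * n ^ 2
      = |coeff n S| * ((n : ℝ) ^ 4 * (1 / 4) ^ n) * 4 ^ n := by
        rw [one_div_pow]
        field_simp
    _ ≤ B * K * (4 * n ^ 2 * treeCount n) := by
        gcongr
        exact four_pow_le_treeCount hn
    _ = 4 * B * K * treeCount n * n ^ 2 := by ring

end transfer

/-- The proportion of trees with protection number at least `k` among the plane trees with `n`
vertices. -/
noncomputable def tailProb (n k : ℕ) : ℝ := coeff n (tailGenFun k) / treeCount n

theorem tailProb_zero {n : ℕ} (hn : 1 ≤ n) : tailProb n 0 = 1 :=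
  div_self (treeCount_pos hn).ne'

theorem tailProb_one {n : ℕ} (hn : 2 ≤ n) : tailProb n 1 = 1 := by
  rw [tailProb, tailGenFun_one, map_sub, coeff_X, if_neg (by omega), sub_zero]
  exact div_self (treeCount_pos (by omega)).ne'

theorem tailProb_add_two (n m : ℕ) :
    tailProb n (m + 2) = coeff n (X ^ m * mainFactor m * tailGenFun 0) / treeCount n +
      coeff n (X ^ m * regularPart m) / treeCount n := by
  rw [tailProb, tailGenFun_eq, map_add, add_div]

theorem exists_abs_tailProb_add_two_sub_le :
    ∃ C : ℝ, 0 ≤ C ∧ ∀ n : ℕ, 1 ≤ n → ∀ m : ℕ,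
      |tailProb n (m + 2) - (term0 (m + 2) + term1 (m + 2) / n)| ≤ C * (1 / 3) ^ m / n ^ 2 := by
  have hρ : (0 : ℝ) ≤ 1 / 3 := by norm_num
  obtain ⟨B, hB⟩ := exists_add_one_pow_mul_pow_le (r := 1 / 4) (ρ := 1 / 3) 6 (by norm_num)
    (by norm_num)
  obtain ⟨B', hB'⟩ := exists_add_one_pow_mul_pow_le (r := 1 / 4) (ρ := 1 / 3) 4 (by norm_num)
    (by norm_num)
  refine ⟨32 * B + 16 * B', ?_, fun n hn m => ?_⟩
  · linarith [show 1 ≤ B by simpa using hB 0, show 1 ≤ B' by simpa using hB' 0]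
  · have hmain := abs_coeff_mul_tailGenFun_zero_div_sub_le hρ hB
      (truncNorm_X_pow_mul_mainFactor_le m) (hasValueAt_X_pow_mul_mainFactor m)
      (hasValueAt_eulerDerivation_X_pow_mul_mainFactor m) hn
    have hrem := abs_coeff_div_treeCount_le hρ hB' (truncNorm_X_pow_mul_regularPart_le m) hn
    rw [← mul_assoc, show (3 / 2 * (2 / 3) : ℝ) = 1 by norm_num, one_mul] at hmain
    rw [tailProb_add_two, add_sub_right_comm]
    refine (abs_add_le _ _).trans ((add_le_add hmain hrem).trans_eq ?_)
    ring

theorem exists_abs_tailProb_sub_le :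
    ∃ C : ℝ, 0 ≤ C ∧ ∀ n : ℕ, 2 ≤ n → ∀ k : ℕ, 1 ≤ k →
      |tailProb n k - (term0 k + term1 k / n)| ≤ C * (1 / 3) ^ k / n ^ 2 := by
  obtain ⟨C, hC, h⟩ := exists_abs_tailProb_add_two_sub_le
  refine ⟨9 * C, by positivity, fun n hn k hk => ?_⟩
  obtain rfl | ⟨m, rfl⟩ : k = 1 ∨ ∃ m, k = m + 2 :=
    hk.eq_or_lt.imp Eq.symm fun hk => ⟨k - 2, by omega⟩
  · rw [tailProb_one hn, show term0 1 = 1 by norm_num [term0], show term1 1 = 0 by norm_num [term1],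
      zero_div, add_zero, sub_self, abs_zero]
    positivity
  · refine (h n (by omega) m).trans_eq ?_
    ring

instance : DiscreteMeasurableSpace PlaneTree := ⟨fun _ => trivial⟩

theorem coe_finsetOfSize (n : ℕ) : (finsetOfSize n : Set PlaneTree) = ofSize n :=
  (finite_ofSize n).coe_toFinset

theorem treeCount_eq_card (n : ℕ) : treeCount n = (finsetOfSize n).card := by
  simp [treeCount, tailGenFun, coeff_genFun]

theorem isProbabilityMeasure_uniformLaw {n : ℕ} (hn : 1 ≤ n) :
    IsProbabilityMeasure (uniformLaw n) := by
  refine isProbabilityMeasure_uniformOn (finite_ofSize n) ?_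
  have hcard := treeCount_pos hn
  rw [treeCount_eq_card, Nat.cast_pos, Finset.card_pos] at hcard
  rwa [← coe_finsetOfSize, Finset.coe_nonempty]

theorem memLp_uniformLaw {n : ℕ} (hn : 1 ≤ n) (f : PlaneTree → ℝ) (p : ENNReal) :
    MemLp f p (uniformLaw n) := by
  have := isProbabilityMeasure_uniformLaw hn
  refine MemLp.of_bound Measurable.of_discrete.aestronglyMeasurable
    (∑ t ∈ finsetOfSize n, ‖f t‖) ?_
  filter_upwards [ae_cond_mem (μ := Measure.count) (s := ofSize n) .of_discrete] with t ht
  exact Finset.single_le_sum (f := fun t => ‖f t‖) (fun _ _ => norm_nonneg _)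
    (mem_finsetOfSize.2 ht)

theorem integral_uniformLaw (n : ℕ) (f : PlaneTree → ℝ) :
    ∫ t, f t ∂(uniformLaw n) = (∑ t ∈ finsetOfSize n, f t) / treeCount n := by
  have hf : IntegrableOn f (finsetOfSize n) Measure.count := by
    rw [← (finsetOfSize n : Set PlaneTree).biUnion_of_singleton]
    simp [integrableOn_finset_iUnion]
  rw [uniformLaw, uniformOn, ProbabilityTheory.cond, integral_smul_measure, ← coe_finsetOfSize,
    setIntegral_finset _ hf, treeCount_eq_card, Measure.count_apply_finset]
  simp [Measure.real, div_eq_inv_mul]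

theorem tailProb_eq_sum_div (n k : ℕ) :
    tailProb n k = (∑ t ∈ finsetOfSize n, {t : PlaneTree | k ≤ t.protectionNumber}.indicator 1 t) /
      treeCount n := by
  rw [tailProb, tailGenFun, coeff_genFun]

theorem prob_eq_tailProb_sub (n k : ℕ) : prob n k = tailProb n k - tailProb n (k + 1) := by
  classical
  rw [prob, ← integral_indicator_one .of_discrete, integral_uniformLaw, tailProb_eq_sum_div,
    tailProb_eq_sum_div, ← sub_div, ← Finset.sum_sub_distrib]
  congr 1
  refine Finset.sum_congr rfl fun t _ => ?_
  simp only [Set.indicator_apply, Set.mem_ofPred_eq, Pi.one_apply]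
  split_ifs <;> first | omega | norm_num

/-- Summation by parts: `∑ k < Xₙ, a k = ∑ k, a k * 1_{k < Xₙ}`. -/
theorem hasSum_mul_tailProb (a : ℕ → ℝ) (n : ℕ) :
    HasSum (fun k => a k * tailProb n (k + 1))
      (∫ t, ∑ k ∈ Finset.range t.protectionNumber, a k ∂(uniformLaw n)) := by
  have hterm (t : PlaneTree) :
      HasSum (fun k => a k * {t : PlaneTree | k + 1 ≤ t.protectionNumber}.indicator 1 t)
        (∑ k ∈ Finset.range t.protectionNumber, a k) := by
    simp only [Set.indicator_apply, Set.mem_ofPred_eq, Pi.one_apply, mul_ite, mul_one, mul_zero,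
      Nat.succ_le_iff, ← Finset.mem_range]
    rw [← Finset.sum_congr rfl fun k hk => if_pos hk]
    exact hasSum_sum_of_ne_finset_zero fun k hk => if_neg hk
  rw [integral_uniformLaw]
  simp only [tailProb_eq_sum_div, ← mul_div_assoc, Finset.mul_sum]
  exact (hasSum_sum fun t _ => hterm t).div_const (treeCount n)

theorem hasSum_tailProb_expectation (n : ℕ) :
    HasSum (fun k => tailProb n (k + 1)) (expectation n) := by
  simpa [expectation] using hasSum_mul_tailProb 1 n

theorem sum_range_two_mul_succ_sub_one (p : ℕ) :
    ∑ k ∈ Finset.range p, (2 * ((k + 1 : ℕ) : ℝ) - 1) = (p : ℝ) ^ 2 := by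
  induction p with
  | zero => simp
  | succ p ih =>
    rw [Finset.sum_range_succ, ih]
    push_cast
    ring

theorem hasSum_tailProb_secondMoment (n : ℕ) :
    HasSum (fun k : ℕ => (2 * ((k + 1 : ℕ) : ℝ) - 1) * tailProb n (k + 1))
      (∫ t, (t.protectionNumber : ℝ) ^ 2 ∂(uniformLaw n)) := by
  simpa only [sum_range_two_mul_succ_sub_one] using
    hasSum_mul_tailProb (fun k => 2 * ((k + 1 : ℕ) : ℝ) - 1) n

theorem var_eq_secondMoment_sub {n : ℕ} (hn : 1 ≤ n) :
    var n = ∫ t, (t.protectionNumber : ℝ) ^ 2 ∂(uniformLaw n) - expectation n ^ 2 := by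
  have := isProbabilityMeasure_uniformLaw hn
  exact variance_eq_sub (memLp_uniformLaw hn _ 2)

end PlaneTree

namespace ProtectionNumber

theorem limitProb_eq_term0_sub (k : ℕ) : limitProb k = term0 k - term0 (k + 1) := by
  rw [limitProb, term0, term0, mul_comm 2 k, pow_mul, pow_succ (4 : ℝ) k]
  have hy : (0 : ℝ) < 4 ^ k := by positivity
  generalize (4 : ℝ) ^ k = y at *
  field_simp
  ring

theorem corrProb_eq_term1_sub (k : ℕ) : corrProb k = term1 k - term1 (k + 1) := by
  rw [corrProb, term1, term1]
  simp only [mul_comm _ k, mul_comm _ (k + 1), pow_mul, pow_succ (4 : ℝ) k]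
  have hy : (0 : ℝ) < 4 ^ k := by positivity
  push_cast
  generalize (4 : ℝ) ^ k = y at *
  have hy' : y * 4 + 2 = 2 * (2 * y + 1) := by ring
  rw [hy']
  field_simp
  ring

theorem limitProb_nonneg (k : ℕ) : 0 ≤ limitProb k := by
  have h : (0 : ℝ) ≤ 4 ^ (2 * k) - 1 := sub_nonneg.2 (one_le_pow₀ (by norm_num))
  rw [limitProb]
  positivity

theorem term2_eq (k : ℕ) : term2 k = (2 * (k : ℝ) - 1) * term0 k := by
  rw [term2, term0]
  ring

theorem term3_eq (k : ℕ) : term3 k = (2 * (k : ℝ) - 1) * term1 k := by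
  rw [term3, term1]
  ring

theorem abs_term0_le (k : ℕ) : |term0 k| ≤ 252 * (k + 1) * (1 / 4) ^ k := by
  rw [term0, abs_of_nonneg (by positivity), one_div_pow, mul_one_div,
    div_le_div_iff₀ (by positivity) (by positivity)]
  have hk : (0 : ℝ) ≤ k := by positivity
  have hy : (0 : ℝ) < 4 ^ k := by positivity
  generalize (4 : ℝ) ^ k = y at *
  nlinarith [mul_nonneg hk (sq_nonneg (y + 2))]

theorem abs_term1_le (k : ℕ) : |term1 k| ≤ 252 * (k + 1) * (1 / 4) ^ k := by
  rw [term1, mul_comm 2 k, pow_mul, one_div_pow, mul_one_div]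
  have hk : (0 : ℝ) ≤ k := by positivity
  have hy : (1 : ℝ) ≤ 4 ^ k := one_le_pow₀ (by norm_num)
  generalize (4 : ℝ) ^ k = y at *
  have hnum : |(3 * (k : ℝ) - 8) * y ^ 2 + 28 * y - (12 * k + 20)| ≤ 56 * (k + 1) * y ^ 2 := by
    have hyy : y ≤ y ^ 2 := le_self_pow₀ hy two_ne_zero
    rw [abs_le]
    constructor <;> nlinarith [mul_nonneg hk (sq_nonneg y), mul_le_mul_of_nonneg_left hyy hk]
  rw [abs_div, abs_of_pos (by positivity : 0 < 2 * (y + 2) ^ 4), abs_mul,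
    abs_of_pos (by positivity : 0 < 9 * y)]
  calc _ ≤ 9 * y * (56 * (k + 1) * y ^ 2) / (2 * y ^ 4) := by
        gcongr
        linarith
    _ = 252 * (k + 1) / y := by
        field_simp
        ring

theorem mul_succ_add_two_le_two_pow_succ (k : ℕ) : k * (k + 1) + 2 ≤ 2 ^ (k + 1) := by
  induction k with
  | zero => norm_num
  | succ k ih =>
    rw [pow_succ]
    nlinarith [Nat.le_mul_self k]

theorem abs_mul_le_mul_half_pow {c x : ℝ} {k : ℕ} (hc : |c| ≤ 2 * (k + 1))
    (hx : |x| ≤ 252 * (k + 1) * (1 / 4) ^ k) : |c * x| ≤ 1512 * (1 / 2) ^ k := by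
  have hsq : ((k : ℝ) + 1) ^ 2 ≤ 3 * 2 ^ k := by
    have h := mul_succ_add_two_le_two_pow_succ k
    rw [pow_succ] at h
    exact_mod_cast (by nlinarith [Nat.le_mul_self k] : (k + 1) ^ 2 ≤ 3 * 2 ^ k)
  rw [abs_mul]
  calc |c| * |x| ≤ 2 * (k + 1) * (252 * (k + 1) * (1 / 4) ^ k) := by gcongr
    _ = 504 * ((k : ℝ) + 1) ^ 2 * (1 / 4) ^ k := by ring
    _ ≤ 504 * (3 * 2 ^ k) * (1 / 4) ^ k := by gcongr
    _ = 1512 * (2 * (1 / 4)) ^ k := by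
        rw [mul_pow]
        ring
    _ = 1512 * (1 / 2) ^ k := by norm_num

theorem abs_two_mul_sub_one_le (k : ℕ) : |2 * (k : ℝ) - 1| ≤ 2 * (k + 1) := by
  rw [abs_le]
  constructor <;> linarith [Nat.cast_nonneg (α := ℝ) k]

theorem abs_term0_le_half_pow (k : ℕ) : |term0 k| ≤ 1512 * (1 / 2) ^ k := by
  rw [← one_mul (term0 k)]
  exact abs_mul_le_mul_half_pow (by rw [abs_one]; linarith [Nat.cast_nonneg (α := ℝ) k])
    (abs_term0_le k)

theorem abs_term1_le_half_pow (k : ℕ) : |term1 k| ≤ 1512 * (1 / 2) ^ k := by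
  rw [← one_mul (term1 k)]
  exact abs_mul_le_mul_half_pow (by rw [abs_one]; linarith [Nat.cast_nonneg (α := ℝ) k])
    (abs_term1_le k)

theorem abs_term2_le_half_pow (k : ℕ) : |term2 k| ≤ 1512 * (1 / 2) ^ k := by
  rw [term2_eq]
  exact abs_mul_le_mul_half_pow (abs_two_mul_sub_one_le k) (abs_term0_le k)

theorem abs_term3_le_half_pow (k : ℕ) : |term3 k| ≤ 1512 * (1 / 2) ^ k := by
  rw [term3_eq]
  exact abs_mul_le_mul_half_pow (abs_two_mul_sub_one_le k) (abs_term1_le k)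

theorem summable_of_abs_le_half_pow {f : ℕ → ℝ} {C : ℝ} (h : ∀ k, |f k| ≤ C * (1 / 2) ^ k) :
    Summable f :=
  .of_norm_bounded (summable_geometric_two.mul_left C) h

theorem summable_term0 : Summable term0 := summable_of_abs_le_half_pow abs_term0_le_half_pow

theorem summable_term1 : Summable term1 := summable_of_abs_le_half_pow abs_term1_le_half_pow

theorem summable_term2 : Summable term2 := summable_of_abs_le_half_pow abs_term2_le_half_pow

theorem summable_term3 : Summable term3 := summable_of_abs_le_half_pow abs_term3_le_half_pow

theorem hasSum_limitProb : HasSum limitProb 1 := by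
  rw [hasSum_iff_tendsto_nat_of_nonneg limitProb_nonneg]
  simp only [limitProb_eq_term0_sub, Finset.sum_range_sub']
  have h := (tendsto_const_nhds (x := term0 0)).sub summable_term0.tendsto_atTop_zero
  rwa [show term0 0 - 0 = 1 by norm_num [term0]] at h

theorem abs_sum_div_sub_floor_le {ι : Type*} (s : Finset ι) (num : ι → ℤ) (den : ι → ℕ) {M : ℕ}
    (hM : 0 < M) :
    |∑ i ∈ s, (num i / den i : ℝ) - ((∑ i ∈ s, num i * M / den i : ℤ) : ℝ) / M| ≤
      s.card / M := by
  have hM' : (0 : ℝ) < M := by exact_mod_cast hM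
  have hterm : ∀ i ∈ s, |(num i / den i : ℝ) - ((num i * M / den i : ℤ) : ℝ) / M| ≤ 1 / M := by
    intro i _
    have hfloor : num i * M / den i = ⌊(num i / den i * M : ℝ)⌋ := by
      rw [div_mul_eq_mul_div, Int.floor_div_natCast]
      exact_mod_cast congrArg (· / (den i : ℤ)) (Int.floor_intCast (R := ℝ) (num i * M)).symm
    rw [hfloor, sub_div' hM'.ne', abs_div, abs_of_pos hM']
    gcongr
    rw [Int.self_sub_floor, Int.abs_fract]
    exact (Int.fract_lt_one _).le
  rw [Int.cast_sum, Finset.sum_div, ← Finset.sum_sub_distrib]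
  refine (Finset.abs_sum_le_sum_abs _ _).trans ((Finset.sum_le_card_nsmul _ _ _ hterm).trans_eq ?_)
  rw [nsmul_eq_mul, mul_one_div]

theorem abs_tsum_succ_sub_le {f : ℕ → ℝ} {num : ℕ → ℤ} {den : ℕ → ℕ} {s : ℤ}
    (h : ∀ k, |f k| ≤ 1512 * (1 / 2) ^ k) (hf : ∀ k, f k = num k / den k)
    (hs : ∑ k ∈ Finset.range 240, num (k + 1) * (10 ^ 75 : ℕ) / (den (k + 1) : ℤ) = s) :
    |∑' k, f (k + 1) - s / 10 ^ 75| ≤ 1 / 10 ^ 68 := by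
  have htail : |∑' k, f (k + 1) - ∑ k ∈ Finset.range 240, f (k + 1)| ≤
      756 * (1 / 2) ^ 240 / (1 - 1 / 2) := by
    rw [abs_sub_comm]
    refine norm_sub_le_of_geometric_bound_of_hasSum (by norm_num) (fun k => ?_)
      ((summable_nat_add_iff 1).2 (summable_of_abs_le_half_pow h)).hasSum 240
    refine (h (k + 1)).trans_eq ?_
    rw [pow_succ]
    ring
  have hround : |∑ k ∈ Finset.range 240, f (k + 1) - s / 10 ^ 75| ≤ 240 / 10 ^ 75 := by
    have hfloor := abs_sum_div_sub_floor_le (Finset.range 240) (fun k => num (k + 1))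
      (fun k => den (k + 1)) (M := 10 ^ 75) (by norm_num)
    rw [hs, Finset.card_range] at hfloor
    simpa only [hf, Nat.cast_pow, Nat.cast_ofNat] using hfloor
  refine (abs_sub_le _ _ _).trans ((add_le_add htail hround).trans ?_)
  norm_num

theorem abs_tsum_term0_sub_le :
    |∑' k, term0 (k + 1) -
      1622971384715353049514658203184345989635513668984063539407824762058373583892 / 10 ^ 75| ≤
      1 / 10 ^ 68 := by
  -- The powers are computed in `ℕ`, where the kernel has fast arithmetic.
  have hterm (k : ℕ) : term0 k =
      (((9 * 4 ^ k : ℕ) : ℤ) : ℝ) / ((4 ^ k + 2) ^ 2 : ℕ) := by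
    rw [term0]
    push_cast
    ring
  have h := abs_tsum_succ_sub_le
    (s := 1622971384715353049514658203184345989635513668984063539407824762058373583892)
    abs_term0_le_half_pow hterm (by decide +kernel)
  rwa [Int.cast_ofNat] at h

theorem abs_tsum_term1_sub_le :
    |∑' k, term1 (k + 1) -
      131187368949423182524448581036673383357742941353142827498279652053972442768 / 10 ^ 75| ≤
      1 / 10 ^ 68 := by
  have hterm (k : ℕ) : term1 k =
      (((9 * 4 ^ k : ℕ) * ((3 * k - 8) * (4 ^ (2 * k) : ℕ) + (28 * 4 ^ k : ℕ) -
        (12 * k + 20 : ℕ)) : ℤ) : ℝ) / (2 * (4 ^ k + 2) ^ 4 : ℕ) := by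
    rw [term1]
    push_cast
    ring
  have h := abs_tsum_succ_sub_le
    (s := 131187368949423182524448581036673383357742941353142827498279652053972442768)
    abs_term1_le_half_pow hterm (by decide +kernel)
  rwa [Int.cast_ofNat] at h

theorem abs_tsum_term2_sub_le :
    |∑' k, term2 (k + 1) -
      3349731187388203181466069888750759752824299629276506891428042169690194202970 / 10 ^ 75| ≤
      1 / 10 ^ 68 := by
  have hterm (k : ℕ) : term2 k =
      (((2 * k - 1) * (9 * 4 ^ k : ℕ) : ℤ) : ℝ) / ((4 ^ k + 2) ^ 2 : ℕ) := by
    rw [term2]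
    push_cast
    ring
  have h := abs_tsum_succ_sub_le
    (s := 3349731187388203181466069888750759752824299629276506891428042169690194202970)
    abs_term2_le_half_pow hterm (by decide +kernel)
  rwa [Int.cast_ofNat] at h

theorem abs_tsum_term3_sub_le :
    |∑' k, term3 (k + 1) -
      1177890931091609770090102962415168603431105664285904857796882621821078993353 / 10 ^ 75| ≤
      1 / 10 ^ 68 := by
  have hterm (k : ℕ) : term3 k =
      (((2 * k - 1) * ((9 * 4 ^ k : ℕ) * ((3 * k - 8) * (4 ^ (2 * k) : ℕ) +
        (28 * 4 ^ k : ℕ) - (12 * k + 20 : ℕ))) : ℤ) : ℝ) / (2 * (4 ^ k + 2) ^ 4 : ℕ) := by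
    rw [term3]
    push_cast
    ring
  have h := abs_tsum_succ_sub_le
    (s := 1177890931091609770090102962415168603431105664285904857796882621821078993353)
    abs_term3_le_half_pow hterm (by decide +kernel)
  rwa [Int.cast_ofNat] at h

theorem abs_c0_sub_lt :
    |c0 - 1.622971384715353049514658203184345989635513668984063539407825| < 1 / 10 ^ 60 := by
  have h := abs_le.1 abs_tsum_term0_sub_le
  rw [c0, abs_lt]
  constructor <;> linarith

theorem abs_c1_sub_lt :
    |c1 - 0.1311873689494231825244485810366733833577429413531428274982796| < 1 / 10 ^ 61 := by
  have h := abs_le.1 abs_tsum_term1_sub_le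
  rw [c1, abs_lt]
  constructor <;> linarith

theorem abs_mul_sub_mul_le_of_abs_sub_le {x y a b K ε : ℝ} (hx : |x - a| ≤ ε) (hy : |y - b| ≤ ε)
    (ha : |a| ≤ K) (hb : |b| ≤ K) (hε : ε ≤ 1) : |x * y - a * b| ≤ (2 * K + 1) * ε := by
  have hε0 : 0 ≤ ε := (abs_nonneg _).trans hx
  have hK : 0 ≤ K := (abs_nonneg _).trans ha
  calc |x * y - a * b| = |(x - a) * (y - b) + a * (y - b) + (x - a) * b| := by ring_nf
    _ ≤ |x - a| * |y - b| + |a| * |y - b| + |x - a| * |b| := by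
        simpa only [abs_mul] using abs_add_three ((x - a) * (y - b)) (a * (y - b)) ((x - a) * b)
    _ ≤ 1 * ε + K * ε + ε * K := by
        gcongr
        exact hx.trans hε
    _ = (2 * K + 1) * ε := by ring

theorem abs_c2_sub_lt :
    |c2 - 0.71569507178333266731548919868273628601066118785422617431075| < 1 / 10 ^ 59 := by
  have h := abs_le.1 abs_tsum_term2_sub_le
  have h' := abs_le.1 (abs_mul_sub_mul_le_of_abs_sub_le (K := 2) abs_tsum_term0_sub_le
    abs_tsum_term0_sub_le (by norm_num [abs_of_pos]) (by norm_num [abs_of_pos]) (by norm_num))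
  rw [c2, c0, sq, abs_lt]
  constructor <;> linarith

theorem abs_c3_sub_lt :
    |c3 - 0.752064239409591264131776195623037076243863867774117959593385| < 1 / 10 ^ 60 := by
  have h := abs_le.1 abs_tsum_term3_sub_le
  have h' := abs_le.1 (abs_mul_sub_mul_le_of_abs_sub_le (K := 2) abs_tsum_term0_sub_le
    abs_tsum_term1_sub_le (by norm_num [abs_of_pos]) (by norm_num [abs_of_pos]) (by norm_num))
  rw [c3, c0, c1, mul_assoc, abs_lt]
  constructor <;> linarith

open PlaneTree

theorem exists_abs_prob_sub_le :
    ∃ C : ℝ, 0 ≤ C ∧ ∀ n : ℕ, 2 ≤ n → ∀ k : ℕ,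
      |prob n k - (limitProb k + corrProb k * (1 / (n : ℝ)))| ≤
        C * ((k : ℝ) ^ 2 / (3 ^ k * (n : ℝ) ^ 2)) := by
  obtain ⟨C, hC, h⟩ := exists_abs_tailProb_sub_le
  refine ⟨2 * C, by positivity, fun n hn k => ?_⟩
  rw [prob_eq_tailProb_sub, limitProb_eq_term0_sub, corrProb_eq_term1_sub]
  rcases Nat.eq_zero_or_pos k with rfl | hk
  · rw [tailProb_zero (by omega), tailProb_one hn]
    norm_num [term0, term1]
  · have hk1 : (1 : ℝ) ≤ (k : ℝ) ^ 2 := one_le_pow₀ (by exact_mod_cast hk)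
    calc |tailProb n k - tailProb n (k + 1) -
          (term0 k - term0 (k + 1) + (term1 k - term1 (k + 1)) * (1 / (n : ℝ)))|
        = |tailProb n k - (term0 k + term1 k / n) -
            (tailProb n (k + 1) - (term0 (k + 1) + term1 (k + 1) / n))| := by ring_nf
      _ ≤ C * (1 / 3) ^ k / n ^ 2 + C * (1 / 3) ^ (k + 1) / n ^ 2 :=
          (abs_sub _ _).trans (add_le_add (h n hn k hk) (h n hn (k + 1) (by omega)))
      _ ≤ C * (1 / 3) ^ k / n ^ 2 + C * (1 / 3) ^ k / n ^ 2 := by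
          gcongr _ + C * ?_ / _
          exact pow_le_pow_of_le_one (by norm_num) (by norm_num) k.le_succ
      _ = 2 * C * (1 / (3 ^ k * n ^ 2)) := by
          rw [one_div_pow]
          field_simp
          ring
      _ ≤ 2 * C * ((k : ℝ) ^ 2 / (3 ^ k * (n : ℝ) ^ 2)) := by gcongr

theorem tendsto_prob (k : ℕ) : Tendsto (fun n => prob n k) atTop (𝓝 (limitProb k)) := by
  obtain ⟨C, -, h⟩ := exists_abs_prob_sub_le
  have hinv : Tendsto (fun n : ℕ => 1 / (n : ℝ)) atTop (𝓝 0) := tendsto_one_div_atTop_nhds_zero_nat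
  have hO : (fun n : ℕ => prob n k - (limitProb k + corrProb k * (1 / (n : ℝ)))) =O[atTop]
      fun n : ℕ => (1 / (n : ℝ)) ^ 2 := by
    refine .of_bound (C * ((k : ℝ) ^ 2 / 3 ^ k)) (eventually_atTop.2 ⟨2, fun n hn => ?_⟩)
    refine (h n hn k).trans_eq ?_
    rw [Real.norm_of_nonneg (by positivity), one_div_pow]
    field_simp
  have hzero := hO.trans_tendsto (by simpa using hinv.pow 2)
  simpa using hzero.add ((hinv.const_mul (corrProb k)).const_add (limitProb k))

theorem isBigO_moment_sub {a m : ℕ → ℝ} {s₀ s₁ : ℝ}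
    (ha : Summable fun k => |a k| * (1 / 3) ^ (k + 1))
    (h₀ : HasSum (fun k => a k * term0 (k + 1)) s₀)
    (h₁ : HasSum (fun k => a k * term1 (k + 1)) s₁)
    (hm : ∀ n, HasSum (fun k => a k * tailProb n (k + 1)) (m n)) :
    (fun n : ℕ => m n - (s₀ + s₁ * (1 / (n : ℝ)))) =O[atTop] fun n : ℕ => (1 / (n : ℝ)) ^ 2 := by
  obtain ⟨C, -, h⟩ := exists_abs_tailProb_sub_le
  refine .of_bound (C * ∑' k, |a k| * (1 / 3) ^ (k + 1)) (eventually_atTop.2 ⟨2, fun n hn => ?_⟩)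
  have hterm (k : ℕ) : ‖a k * tailProb n (k + 1) -
      (a k * term0 (k + 1) + a k * term1 (k + 1) * (1 / (n : ℝ)))‖ ≤
        C * (1 / (n : ℝ)) ^ 2 * (|a k| * (1 / 3) ^ (k + 1)) :=
    calc _ = |a k| * |tailProb n (k + 1) - (term0 (k + 1) + term1 (k + 1) / n)| := by
          rw [← abs_mul, Real.norm_eq_abs]
          ring_nf
      _ ≤ |a k| * (C * (1 / 3) ^ (k + 1) / n ^ 2) := by
          gcongr
          exact h n hn (k + 1) (by omega)
      _ = _ := by ring
  rw [← ((hm n).sub (h₀.add (h₁.mul_right _))).tsum_eq]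
  refine (tsum_of_norm_bounded (ha.mul_left _).hasSum hterm).trans_eq ?_
  rw [tsum_mul_left, Real.norm_of_nonneg (by positivity)]
  ring

theorem isBigO_expectation_sub :
    (fun n : ℕ => expectation n - (c0 + c1 * (1 / (n : ℝ)))) =O[atTop]
      fun n : ℕ => (1 / (n : ℝ)) ^ 2 := by
  refine isBigO_moment_sub (a := 1) ?_ ?_ ?_ fun n => ?_
  · simpa using (summable_nat_add_iff 1).2
      (summable_geometric_of_lt_one (r := (1 / 3 : ℝ)) (by norm_num) (by norm_num))
  · simpa [c0] using ((summable_nat_add_iff 1).2 summable_term0).hasSum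
  · simpa [c1] using ((summable_nat_add_iff 1).2 summable_term1).hasSum
  · simpa using hasSum_tailProb_expectation n

theorem summable_abs_two_mul_sub_one_mul_pow :
    Summable fun k : ℕ => |2 * ((k + 1 : ℕ) : ℝ) - 1| * (1 / 3) ^ (k + 1) := by
  have hpow := summable_pow_mul_geometric_of_norm_lt_one 1 (r := (1 / 3 : ℝ)) (by norm_num)
  refine .of_nonneg_of_le (fun _ => by positivity) (fun k => ?_)
    ((summable_nat_add_iff 1).2 (hpow.mul_left 2))
  rw [← mul_assoc, pow_one]
  gcongr
  rw [abs_le]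
  push_cast
  constructor <;> linarith [Nat.cast_nonneg (α := ℝ) k]

theorem isBigO_secondMoment_sub :
    (fun n : ℕ => ∫ t, (t.protectionNumber : ℝ) ^ 2 ∂(uniformLaw n) -
      (∑' k, term2 (k + 1) + (∑' k, term3 (k + 1)) * (1 / (n : ℝ)))) =O[atTop]
        fun n : ℕ => (1 / (n : ℝ)) ^ 2 := by
  refine isBigO_moment_sub summable_abs_two_mul_sub_one_mul_pow ?_ ?_ hasSum_tailProb_secondMoment
  · simpa only [term2_eq] using ((summable_nat_add_iff 1).2 summable_term2).hasSum
  · simpa only [term3_eq] using ((summable_nat_add_iff 1).2 summable_term3).hasSum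

theorem isBigO_mul_sub_of_isBigO_sub {α 𝕜 : Type*} [NormedField 𝕜] {l : Filter α} {f g u : α → 𝕜}
    {a₀ a₁ b₀ b₁ : 𝕜} (hu : u =O[l] fun _ => (1 : 𝕜))
    (hf : (fun x => f x - (a₀ + a₁ * u x)) =O[l] fun x => u x ^ 2)
    (hg : (fun x => g x - (b₀ + b₁ * u x)) =O[l] fun x => u x ^ 2) :
    (fun x => f x * g x - (a₀ * b₀ + (a₀ * b₁ + a₁ * b₀) * u x)) =O[l] fun x => u x ^ 2 := by
  have hu2 : (fun x => u x ^ 2) =O[l] fun _ => (1 : 𝕜) := by simpa using hu.pow 2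
  have haffine (c₀ c₁ : 𝕜) : (fun x => c₀ + c₁ * u x) =O[l] fun _ => (1 : 𝕜) :=
    (isBigO_const_const c₀ one_ne_zero l).add (hu.const_mul_left c₁)
  have hg1 : g =O[l] fun _ => (1 : 𝕜) := by simpa using (hg.trans hu2).add (haffine b₀ b₁)
  have hprod := ((hf.mul hg1).add ((haffine a₀ a₁).mul hg |>.congr_right fun x => mul_comm _ _)).add
    (((isBigO_refl (fun x => u x ^ 2) l).const_mul_left (a₁ * b₁)).congr_right
      fun x => (mul_one _).symm)
  refine hprod.congr (fun x => ?_) fun x => mul_one _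
  ring

theorem isBigO_var_sub :
    (fun n : ℕ => var n - (c2 + c3 * (1 / (n : ℝ)))) =O[atTop] fun n : ℕ => (1 / (n : ℝ)) ^ 2 := by
  have hu : (fun n : ℕ => 1 / (n : ℝ)) =O[atTop] fun _ => (1 : ℝ) :=
    tendsto_one_div_atTop_nhds_zero_nat.isBigO_one ℝ
  refine (isBigO_secondMoment_sub.sub (isBigO_mul_sub_of_isBigO_sub hu isBigO_expectation_sub
    isBigO_expectation_sub)).congr' ?_ .rfl
  filter_upwards [eventually_ge_atTop 1] with n hn
  rw [var_eq_secondMoment_sub hn, c2, c3]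
  ring

theorem rpow_le_sq_of_le_two {x r : ℝ} (hx : 1 ≤ x) (hr : r ≤ 2) : x ^ r ≤ x ^ 2 := by
  rw [← Real.rpow_natCast]
  exact Real.rpow_le_rpow_of_exponent_le hx (mod_cast hr)

theorem isBigO_one_div_sq_one_div_rpow {r : ℝ} (hr : r ≤ 2) :
    (fun n : ℕ => (1 / (n : ℝ)) ^ 2) =O[atTop] fun n : ℕ => 1 / (n : ℝ) ^ r := by
  refine .of_bound' ?_
  filter_upwards [eventually_ge_atTop 1] with n hn
  have hn1 : (1 : ℝ) ≤ n := by exact_mod_cast hn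
  have : (0 : ℝ) < (n : ℝ) ^ r := Real.rpow_pos_of_pos (by linarith) r
  rw [Real.norm_of_nonneg (by positivity), Real.norm_of_nonneg (by positivity), one_div_pow]
  gcongr
  exact rpow_le_sq_of_le_two hn1 hr

theorem eventually_abs_prob_sub_le_rpow {r : ℝ} (hr : r ≤ 2) :
    ∃ C : ℝ, ∀ᶠ n : ℕ in atTop, ∀ k : ℕ,
      |prob n k - (limitProb k + corrProb k * (1 / (n : ℝ)))| ≤
        C * ((k : ℝ) ^ 2 / (3 ^ k * (n : ℝ) ^ r)) := by
  obtain ⟨C, hC, h⟩ := exists_abs_prob_sub_le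
  refine ⟨C, eventually_atTop.2 ⟨2, fun n hn k => (h n hn k).trans ?_⟩⟩
  have hn1 : (1 : ℝ) ≤ n := by exact_mod_cast (show 1 ≤ n by omega)
  have : (0 : ℝ) < (n : ℝ) ^ r := Real.rpow_pos_of_pos (by linarith) r
  gcongr
  exact rpow_le_sq_of_le_two hn1 hr

end ProtectionNumber

theorem theorem1_general {r : ℝ} (hr : r ≤ 2) :
    (∀ k, 0 ≤ limitProb k) ∧ HasSum limitProb 1 ∧
    (∀ k, Tendsto (fun n => prob n k) atTop (𝓝 (limitProb k))) ∧
    (∃ C : ℝ, ∀ᶠ n : ℕ in atTop, ∀ k : ℕ,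
      |prob n k - (limitProb k + corrProb k * (1 / (n : ℝ)))|
        ≤ C * ((k : ℝ) ^ 2 / (3 ^ k * (n : ℝ) ^ r))) ∧
    (Summable fun k => term0 (k + 1)) ∧ (Summable fun k => term1 (k + 1)) ∧
    (Summable fun k => term2 (k + 1)) ∧ (Summable fun k => term3 (k + 1)) ∧
    |c0 - 1.622971384715353049514658203184345989635513668984063539407825| < 1 / 10 ^ 60 ∧
    |c1 - 0.1311873689494231825244485810366733833577429413531428274982796| < 1 / 10 ^ 61 ∧
    |c2 - 0.71569507178333266731548919868273628601066118785422617431075| < 1 / 10 ^ 59 ∧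
    |c3 - 0.752064239409591264131776195623037076243863867774117959593385| < 1 / 10 ^ 60 ∧
    ((fun n : ℕ => expectation n - (c0 + c1 * (1 / (n : ℝ))))
      =O[atTop] fun n : ℕ => 1 / (n : ℝ) ^ r) ∧
    ((fun n : ℕ => var n - (c2 + c3 * (1 / (n : ℝ))))
      =O[atTop] fun n : ℕ => 1 / (n : ℝ) ^ r) := by
  refine ⟨limitProb_nonneg, hasSum_limitProb, tendsto_prob, eventually_abs_prob_sub_le_rpow hr,
    ?_, ?_, ?_, ?_, abs_c0_sub_lt, abs_c1_sub_lt, abs_c2_sub_lt, abs_c3_sub_lt,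
    isBigO_expectation_sub.trans (isBigO_one_div_sq_one_div_rpow hr),
    isBigO_var_sub.trans (isBigO_one_div_sq_one_div_rpow hr)⟩
  exacts [(summable_nat_add_iff 1).2 summable_term0, (summable_nat_add_iff 1).2 summable_term1,
    (summable_nat_add_iff 1).2 summable_term2, (summable_nat_add_iff 1).2 summable_term3]

theorem theorem1 :
    -- the limit distribution is a probability distribution, and `X_n` converges to it
    (∀ k, 0 ≤ limitProb k) ∧ HasSum limitProb 1 ∧
    (∀ k, Tendsto (fun n => prob n k) atTop (𝓝 (limitProb k))) ∧
    -- the expansion of `P(X_n = k)`, uniformly in `k`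
    (∃ C : ℝ, ∀ᶠ n : ℕ in atTop, ∀ k : ℕ,
      |prob n k - (limitProb k + corrProb k * (1 / (n : ℝ)))|
        ≤ C * ((k : ℝ) ^ 2 / (3 ^ k * (n : ℝ) ^ (3 / 2 : ℝ)))) ∧
    -- the series defining the constants converge
    (Summable fun k => term0 (k + 1)) ∧ (Summable fun k => term1 (k + 1)) ∧
    (Summable fun k => term2 (k + 1)) ∧ (Summable fun k => term3 (k + 1)) ∧
    -- their numerical values, to within one unit of the last digit
    |c0 - 1.622971384715353049514658203184345989635513668984063539407825| < 1 / 10 ^ 60 ∧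
    |c1 - 0.1311873689494231825244485810366733833577429413531428274982796| < 1 / 10 ^ 61 ∧
    |c2 - 0.71569507178333266731548919868273628601066118785422617431075| < 1 / 10 ^ 59 ∧
    |c3 - 0.752064239409591264131776195623037076243863867774117959593385| < 1 / 10 ^ 60 ∧
    -- expectation and variance
    ((fun n : ℕ => expectation n - (c0 + c1 * (1 / (n : ℝ))))
      =O[atTop] fun n : ℕ => 1 / (n : ℝ) ^ (3 / 2 : ℝ)) ∧
    ((fun n : ℕ => var n - (c2 + c3 * (1 / (n : ℝ))))
      =O[atTop] fun n : ℕ => 1 / (n : ℝ) ^ (3 / 2 : ℝ)) :=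
  theorem1_general (by norm_num)
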